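/- Fix the following data. (a) A smooth even function $\psi:\mathbb R\to[0,1]$ with $\operatorname{supp}\psi\subset(-1,-1/4)\cup(1/4,1)$ and $\psi=1$ on $[-3/4,-1/2]\cup[1/2,3/4]$. For $t\ge 0$ put $\phi_t(x)=1-\sum_{n\in\mathbb Z}\psi(4^t(x+2n))$. (b) A smooth, positive, even, $2$-periodic function $q:\mathbb R\to(0,\infty)$, strictly increasing on $[-1,0]$ and strictly decreasing on $[0,1]$, which is so flat at $0$ that $q_t:=\phi_t\,(q-q(4^{-t}))+q(4^{-t})$ converges to $q$ in the $C^\infty$ topology as $t\to\infty$. (c) A smooth even function $h:\mathbb R\to\mathbb R$ with $\operatorname{supp}h\subset(-3/4,-1/2)\cup(1/2,3/4)$ and a point $x_\infty\in(1/2,3/4)$ such that, for some strictly decreasing sequence $x_1>x_2>\dots$ in $(x_\infty,3/4)$ converging to $x_\infty$ and some $C>1$, for all $i\ge1$ one has $(-1)^ih<0$ on $(x_{i+1},x_i)$ and $$\Bigl|\int_{x_{i+1}}^{x_i}h\,dx\Bigr|\ \ge\ C\sum_{j=i+1}^\infty\Bigl|\int_{x_{j+1}}^{x_j}h\,dx\Bigr|.$$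 For $t\ge0$ put $H_t(x)=\sum_{n\in\mathbb Z}h(4^t(x+2n))$. For a finite set $S\subset[0,\infty)$ any two distinct points of which are at distance at least $1$, and $\tau:S\to\mathbb R$, define $q_{S,\tau}$ recursively: $q_{\varnothing,\tau}=q$, and if $S\neq\varnothing$, choose $t\in S$, let $S'=S\setminus\{t\}$, $\tau'=\tau|_{S'}$, and $$q_{S,\tau}(x)=\phi_t(x)\bigl(q_{S',\tau'}(x)-q_{S',\tau'}(4^{-t})\bigr)+q_{S',\tau'}(4^{-t})+\tau(t)H_t(x)$$ (the result does not depend on the choices). For a smooth, positive, even, $2$-periodic $Q$ and a positive integer $m$, let $\Lambda_{Q,m}$ be the smallest $\lambda\in\mathbb R$ for which $u''+(\lambda Q-m^2)u=0$ on $[0,4]$, $u(0)=u(4)=0$, has a solution $u\not\equiv0$. **Proposition.** There exist positive integers $m_1<m_2<\cdots$, numbers $\varepsilon_1,\varepsilon_2,\ldots\in(0,\infty)$, and $M_0=0,M_1,M_2,\ldots\in[0,\infty)$ with $M_{i+1}>M_i+1$ for all $i\ge0$, such that for every $k\in\mathbb N$ and all $\tau_1,\dots,\tau_k\in\mathbb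 R$ with $|\tau_i|\le\varepsilon_i$ there are $t_1,\dots,t_k$ with $t_i\in[M_{i-1}+1,M_i]$, $i=1,\dots,k$, having the following property: for $S=\{t_1,\dots,t_k\}$ and $\tau:S\to\mathbb R$, $\tau(t_i)=\tau_i$, the function $Q=q_{S,\tau}$ is smooth, positive, even and $2$-periodic, and $$\Lambda_{Q,m_i}\,Q(4^{-t_i}x_\infty)-m_i^2=0\qquad\text{for } i=1,\dots,k.$$ -/

import Mathlib

open Set Filter Topology
open scoped ContDiff

noncomputable section

/-- A smooth even cutoff `ψ : ℝ → [0,1]` with (closed) support in `(-1,-1/4) ∪ (1/4,1)` and equal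
to `1` on `[-3/4,-1/2] ∪ [1/2,3/4]`. -/
structure IsCutoff (ψ : ℝ → ℝ) : Prop where
  smooth : ContDiff ℝ ∞ ψ
  even : ∀ x, ψ (-x) = ψ x
  mem_Icc : ∀ x, ψ x ∈ Icc (0 : ℝ) 1
  supp : tsupport ψ ⊆ Ioo (-1) (-(1 / 4)) ∪ Ioo (1 / 4) 1
  eq_one : ∀ x ∈ Icc (-(3 / 4) : ℝ) (-(1 / 2)) ∪ Icc (1 / 2) (3 / 4), ψ x = 1

/-- `φ_t(x) = 1 - ∑_{n ∈ ℤ} ψ(4^t (x + 2n))`. For a cutoff `ψ` and `t ≥ 0` at most one term of the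
sum is nonzero at each point. -/
def cutPhi (ψ : ℝ → ℝ) (t x : ℝ) : ℝ :=
  1 - ∑' n : ℤ, ψ ((4 : ℝ) ^ t * (x + 2 * n))

/-- `q_t(x) = φ_t(x) (q(x) - q(4^{-t})) + q(4^{-t})`. -/
def plateau (ψ q : ℝ → ℝ) (t x : ℝ) : ℝ :=
  cutPhi ψ t x * (q x - q ((4 : ℝ) ^ (-t))) + q ((4 : ℝ) ^ (-t))

/-- A positive, smooth, even, `2`-periodic function on the line. -/
structure IsWeight (Q : ℝ → ℝ) : Prop where
  smooth : ContDiff ℝ ∞ Q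
  pos : ∀ x, 0 < Q x
  even : ∀ x, Q (-x) = Q x
  periodic : ∀ x, Q (x + 2) = Q x

/-- The base function `q`: a weight, strictly increasing on `[-1,0]`, strictly decreasing on
`[0,1]`, and so flat at `0` that `q_t → q` in the `C^∞` topology as `t → ∞` (all derivatives
converge uniformly). -/
structure IsBaseProfile (ψ q : ℝ → ℝ) : Prop extends IsWeight q where
  strictMono : StrictMonoOn q (Icc (-1) 0)
  strictAnti : StrictAntiOn q (Icc 0 1)
  flat : ∀ n : ℕ, TendstoUniformly (fun t : ℝ => iteratedDeriv n (plateau ψ q t))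
    (iteratedDeriv n q) atTop

/-- A smooth even `h` with (closed) support in `(-3/4,-1/2) ∪ (1/2,3/4)`, having infinitely many
rapidly decaying oscillations to the right of `xinf`. The sequence is indexed from `0` here, so
`x i` is the `(i+1)`-st point. The series converges for every such `h`, since `h` is
integrable. -/
structure IsOscillating (h : ℝ → ℝ) (xinf : ℝ) : Prop where
  smooth : ContDiff ℝ ∞ h
  even : ∀ x, h (-x) = h x
  supp : tsupport h ⊆ Ioo (-(3 / 4)) (-(1 / 2)) ∪ Ioo (1 / 2) (3 / 4)
  mem : xinf ∈ Ioo (1 / 2 : ℝ) (3 / 4)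
  oscillates : ∃ x : ℕ → ℝ, StrictAnti x ∧ (∀ i, x i ∈ Ioo xinf (3 / 4)) ∧
    Tendsto x atTop (𝓝 xinf) ∧
    (∀ i, ∀ y ∈ Ioo (x (i + 1)) (x i), (-1) ^ (i + 1) * h y < 0) ∧
    ∃ C : ℝ, 1 < C ∧ ∀ i,
      C * ∑' l : ℕ, |∫ y in (x (i + 1 + l + 1))..(x (i + 1 + l)), h y| ≤
        |∫ y in (x (i + 1))..(x i), h y|

/-- `H_t(x) = ∑_{n ∈ ℤ} h(4^t (x + 2n))`. -/
def cascadeH (h : ℝ → ℝ) (t x : ℝ) : ℝ :=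
  ∑' n : ℤ, h ((4 : ℝ) ^ t * (x + 2 * n))

open scoped Classical in
/-- The function `q_{S,τ}` for a finite set `S` and `τ : S → ℝ`: `q_{∅,τ} = q`, and for nonempty
`S` one chooses some `t ∈ S`, puts `S' = S \ {t}`, `τ' = τ|_{S'}`, and
`q_{S,τ}(x) = φ_t(x) (q_{S',τ'}(x) - q_{S',τ'}(4^{-t})) + q_{S',τ'}(4^{-t}) + τ(t) H_t(x)`.
For `1`-separated `S ⊆ [0,∞)` the result does not depend on the choices. -/
def cascade (ψ q h : ℝ → ℝ) (S : Finset ℝ) (τ : S → ℝ) : ℝ → ℝ :=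
  if hS : ∃ a, a ∈ S then
    let t : ℝ := hS.choose
    let g : ℝ → ℝ := cascade ψ q h (S.erase t)
      (fun s => τ ⟨s.1, Finset.mem_of_mem_erase s.2⟩)
    fun x => cutPhi ψ t x * (g x - g ((4 : ℝ) ^ (-t))) + g ((4 : ℝ) ^ (-t))
      + τ ⟨t, hS.choose_spec⟩ * cascadeH h t x
  else q
termination_by S.card
decreasing_by exact Finset.card_erase_lt_of_mem hS.choose_spec

/-- The set of (real) eigenvalues `l` of the Dirichlet problem
`u'' + (l Q - m²) u = 0` on `[0,4]`, `u(0) = u(4) = 0`, `u ≢ 0`. The function `v` is `u'`, and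
derivatives at the end points are one-sided. -/
def dirichletEigenvalues (Q : ℝ → ℝ) (m : ℝ) : Set ℝ :=
  {l | ∃ u v : ℝ → ℝ, (∃ x ∈ Icc (0 : ℝ) 4, u x ≠ 0) ∧ u 0 = 0 ∧ u 4 = 0 ∧
    ∀ x ∈ Icc (0 : ℝ) 4, HasDerivWithinAt u (v x) (Icc 0 4) x ∧
      HasDerivWithinAt v (-((l * Q x - m ^ 2) * u x)) (Icc 0 4) x}

/-- `L` is the first (smallest) eigenvalue `Λ_{Q,m}` of the Dirichlet problem. -/
def IsFirstDirichletEigenvalue (Q : ℝ → ℝ) (m L : ℝ) : Prop :=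
  IsLeast (dirichletEigenvalues Q m) L

end

/-! The resonance conditions are `k` equations in the `k` unknown scales, and the Poincaré–Miranda
theorem solves them on the box of all `t` with `t i ∈ [M i + 1, M (i + 1)]` (indices start at `0`).

For `1`-separated scales the annuli on which the modifications act are disjoint, so the recursive
definition collapses to a sum of independent terms (`cascade_eq`). Since `h` takes both signs
arbitrarily close to `xinf`, it vanishes there, and `Q(4^{-t_i} xinf) = q(4^{-t_i})`. It remains to
find a zero of `F_i(t) = Λ_{Q,m_i} q(4^{-t_i}) - m_i²`.

On the face `t_i = M_i + 1`, a half sine wave supported near `x = 2`, where `Q` is close to its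
maximum, bounds `Λ` from above. The earlier scales do not act there and the later ones lower `Q`
only slightly. As `q(4^{-(M_i+2)}) > q(4^{-(M_i+1)})`, a large `m_i` gives `F_i ≤ 0`. On the face
`t_i = M_{i+1}`, the bound `Q ≤ q(0)` and a Poincaré inequality give `Λ q(0) ≥ m_i² + 1/100`, so
`F_i ≥ 0` once `q(4^{-M_{i+1}})` is close to `q(0)`. Both estimates are uniform in the other scales.
The choices are made in the order `m_i`, `M_{i+1}`, `ε_i`, then the next window.

Continuity of `Λ` in `t` comes from its variational form `groundLevel`; a Prüfer angle argument
identifies this number with the smallest Dirichlet eigenvalue. -/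

section Miranda

/-! ### Kuhn's cubical lemma and the Poincaré–Miranda theorem -/

variable {ι : Type*} [DecidableEq ι]

/-- The lattice point following `x` in the direction `j`. -/
def latticeStep (x : ι → ℕ) (j : ι) : ι → ℕ := fun k => x k + if k = j then 1 else 0

@[simp] theorem latticeStep_same (x : ι → ℕ) (j : ι) : latticeStep x j j = x j + 1 := by
  simp [latticeStep]

@[simp] theorem latticeStep_of_ne (x : ι → ℕ) {j k : ι} (h : k ≠ j) : latticeStep x j k = x k := by
  simp [latticeStep, h]

theorem latticeStep_comm (x : ι → ℕ) (j k : ι) :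
    latticeStep (latticeStep x j) k = latticeStep (latticeStep x k) j := by
  ext i; simp only [latticeStep]; ring

/-- Sum over all monotone lattice paths starting at `x` with pairwise distinct steps in `A` of the
product of the increments of the labels `l i`, `i ∈ L`, modulo `2`. -/
def pathSum (l : ι → (ι → ℕ) → ZMod 2) : List ι → Finset ι → (ι → ℕ) → ZMod 2
  | [], _, _ => 1
  | i :: L, A, x =>
    ∑ j ∈ A, (l i (latticeStep x j) - l i x) * pathSum l L (A.erase j) (latticeStep x j)

/-- Each unordered pair of distinct indices is counted twice. This replaces the antisymmetry of the
wedge product: `pathSum` plays the role of the integral of `dl₁ ∧ ⋯ ∧ dlₙ` over a unit cube, modulo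
`2`. -/
theorem sum_erase_symm_eq_zero (A : Finset ι) (f : ι → ι → ZMod 2)
    (hf : ∀ i j, f i j = f j i) : ∑ i ∈ A, ∑ j ∈ A.erase i, f i j = 0 := by
  induction A using Finset.induction_on with
  | empty => simp
  | insert a A ha ih =>
    rw [Finset.sum_insert ha, Finset.erase_insert ha]
    have : ∀ i ∈ A, ∑ j ∈ (insert a A).erase i, f i j = f i a + ∑ j ∈ A.erase i, f i j := by
      intro i hi
      have hia : a ≠ i := fun h => ha (h ▸ hi)
      rw [Finset.erase_insert_of_ne hia, Finset.sum_insert (by simp [ha])]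
    rw [Finset.sum_congr rfl this, Finset.sum_add_distrib, ih, add_zero,
      Finset.sum_congr rfl (fun i _ => hf i a), CharTwo.add_self_eq_zero]

/-- The discrete Stokes formula. -/
theorem pathSum_stokes (l : ι → (ι → ℕ) → ZMod 2) (L : List ι) :
    ∀ (A : Finset ι) (x : ι → ℕ), A.card = L.length + 1 →
      ∑ j ∈ A, pathSum l L (A.erase j) (latticeStep x j)
        = ∑ j ∈ A, pathSum l L (A.erase j) x := by
  induction L with
  | nil => intro A x _; simp [pathSum]
  | cons i L ih =>
    intro A x hA
    have hc : ∀ j ∈ A, (A.erase j).card = L.length + 1 := by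
      intro j hj
      rw [Finset.card_erase_of_mem hj, hA]; simp
    -- The values of `l i` at the points two steps from `x` enter symmetrically in the two
    -- directions and cancel; the induction hypothesis moves the remaining inner sums back by one
    -- step.
    have h1 : ∑ j ∈ A, pathSum l (i :: L) (A.erase j) (latticeStep x j)
        = ∑ j ∈ A, l i (latticeStep x j) *
          ∑ k ∈ A.erase j, pathSum l L ((A.erase j).erase k) (latticeStep x j) := by
      simp only [pathSum, sub_mul, Finset.sum_sub_distrib]
      rw [sum_erase_symm_eq_zero A (fun j k => l i (latticeStep (latticeStep x j) k) *
        pathSum l L ((A.erase j).erase k) (latticeStep (latticeStep x j) k))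
        (fun j k => by rw [latticeStep_comm, Finset.erase_right_comm]), zero_sub, CharTwo.neg_eq]
      refine Finset.sum_congr rfl fun j hj => ?_
      rw [← ih _ _ (hc j hj), Finset.mul_sum]
    have h2 : ∑ j ∈ A, pathSum l (i :: L) (A.erase j) x
        = (∑ k ∈ A, ∑ j ∈ A.erase k, l i (latticeStep x j) *
            pathSum l L ((A.erase k).erase j) (latticeStep x j))
          - l i x * ∑ k ∈ A, ∑ j ∈ A.erase k, pathSum l L ((A.erase k).erase j) x := by
      simp only [pathSum, sub_mul, Finset.sum_sub_distrib]
      congr 1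
      rw [Finset.mul_sum]
      refine Finset.sum_congr rfl fun j hj => ?_
      rw [← Finset.mul_sum, ih _ _ (hc j hj)]
    rw [h1, h2, sum_erase_symm_eq_zero A (fun k j => pathSum l L ((A.erase k).erase j) x)
      (fun j k => by rw [Finset.erase_right_comm]), mul_zero, sub_zero]
    simp only [Finset.mul_sum]
    rw [Finset.sum_comm' (t' := A) (s' := fun j => A.erase j)
      (fun j k => by simp only [Finset.mem_erase]; tauto)]
    refine Finset.sum_congr rfl fun j _ => Finset.sum_congr rfl fun k _ => ?_
    rw [Finset.erase_right_comm]

/-- With direction `j` excluded, paths stay in the hyperplane `x j = c`, where `l j` is constant;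
every product then contains a zero increment. -/
theorem pathSum_eq_zero_of_face {l : ι → (ι → ℕ) → ZMod 2} {j : ι} {c : ℕ}
    (hl : ∀ x y : ι → ℕ, x j = c → y j = c → l j x = l j y) {L : List ι} :
    ∀ {A : Finset ι} {x : ι → ℕ}, j ∈ L → j ∉ A → x j = c → pathSum l L A x = 0 := by
  induction L with
  | nil => intro A x h; simp at h
  | cons i L ih =>
    intro A x hj hA hx
    refine Finset.sum_eq_zero fun k hk => ?_
    have hkj : j ≠ k := fun h => hA (h ▸ hk)
    have hx' : (latticeStep x k) j = c := by rw [latticeStep_of_ne _ hkj, hx]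
    by_cases hij : j = i
    · subst hij
      rw [hl _ _ hx' hx, sub_self, zero_mul]
    · rw [ih (by simpa [hij] using hj) (by simp [hA]) hx', mul_zero]

/-- A nonzero sum has a nonzero summand, that is, a path along which every label has a nonzero
increment; `y` and `z` are the ends of the step belonging to label `i`. -/
theorem exists_ne_of_pathSum_ne_zero {l : ι → (ι → ℕ) → ZMod 2} {L : List ι} :
    ∀ {A : Finset ι} {x : ι → ℕ}, pathSum l L A x ≠ 0 → ∀ i ∈ L, ∃ y z : ι → ℕ,
      (∀ k, x k ≤ y k ∧ y k ≤ x k + if k ∈ A then 1 else 0) ∧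
      (∀ k, x k ≤ z k ∧ z k ≤ x k + if k ∈ A then 1 else 0) ∧ l i y ≠ l i z := by
  induction L with
  | nil => simp
  | cons i L ih =>
    intro A x h i' hi'
    obtain ⟨j, hj, hne⟩ := Finset.exists_ne_zero_of_sum_ne_zero h
    have h1 := left_ne_zero_of_mul hne
    have h2 := right_ne_zero_of_mul hne
    rcases List.mem_cons.1 hi' with rfl | hi'
    · refine ⟨latticeStep x j, x, fun k => ?_, fun k => ⟨le_rfl, by simp⟩, sub_ne_zero.1 h1⟩
      by_cases hk : k = j
      · subst hk; simp [hj]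
      · simp [hk]
    · obtain ⟨y, z, hy, hz, hyz⟩ := ih h2 i' hi'
      have key : ∀ w : ι → ℕ, (∀ k, (latticeStep x j) k ≤ w k ∧
          w k ≤ (latticeStep x j) k + if k ∈ A.erase j then 1 else 0) →
          ∀ k, x k ≤ w k ∧ w k ≤ x k + if k ∈ A then 1 else 0 := by
        intro w hw k
        have := hw k
        by_cases hk : k = j
        · subst hk; simp [hj] at this ⊢; omega
        · simp [hk] at this ⊢; exact this
      exact ⟨y, z, key y hy, key z hz, hyz⟩

variable [Fintype ι]

/-- The lattice points of the face of the cube `[0, p]^ι` with free coordinates in `L`, the other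
coordinates being equal to `p`; upper boundary points in the directions of `L` are omitted. -/
def gridFace (p : ℕ) (L : List ι) : Finset (ι → ℕ) :=
  Fintype.piFinset fun i => if i ∈ L then Finset.range p else {p}

theorem sum_telescope_single (p : ℕ) {L : List ι} {j : ι} (hj : j ∈ L) (g : (ι → ℕ) → ZMod 2) :
    ∑ v ∈ gridFace p L, (g (latticeStep v j) - g v)
      = ∑ v ∈ gridFace p (L.filter (· ≠ j)), (g v - g (Function.update v j 0)) := by
  have key : ∀ f : (ι → ℕ) → ZMod 2, ∑ v ∈ gridFace p L, f v
      = ∑ v ∈ gridFace p (L.filter (· ≠ j)), ∑ s ∈ Finset.range p, f (Function.update v j s) := by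
    intro f
    rw [← Finset.sum_product']
    refine Finset.sum_bij' (fun v _ => (Function.update v j p, v j))
      (fun w _ => Function.update w.1 j w.2) ?_ ?_ ?_ ?_ ?_
    · intro v hv
      simp only [gridFace, Fintype.mem_piFinset, Finset.mem_product] at hv ⊢
      refine ⟨fun i => ?_, by simpa [hj] using hv j⟩
      by_cases hi : i = j
      · subst hi; simp
      · simpa [hi] using hv i
    · rintro ⟨w, s⟩ hw
      simp only [gridFace, Fintype.mem_piFinset, Finset.mem_product] at hw ⊢
      intro i
      by_cases hi : i = j
      · subst hi; simpa [hj] using hw.2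
      · simpa [hi] using hw.1 i
    · intro v _; simp
    · rintro ⟨w, s⟩ hw
      simp only [gridFace, Fintype.mem_piFinset, Finset.mem_product] at hw
      have : w j = p := by simpa using hw.1 j
      simp [← this]
    · intro v _; simp
  rw [key]
  refine Finset.sum_congr rfl fun v hv => ?_
  have hvj : v j = p := by
    simpa using (Fintype.mem_piFinset.1 hv) j
  have : ∀ s, latticeStep (Function.update v j s) j = Function.update v j (s + 1) := by
    intro s; ext i
    by_cases hi : i = j
    · subst hi; simp
    · simp [hi]
  simp only [this]
  rw [Finset.sum_range_sub (fun s => g (Function.update v j s)), ← hvj, Function.update_eq_self]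

/-- By the Stokes formula the integrand is a divergence of terms `l i * pathSum l L`, so the sum
telescopes to the boundary. On faces orthogonal to `j ≠ i` the label `l j` is constant and nothing
survives; in direction `i` only the upper face counts, where `l i = 1`, and it carries the same sum
in one dimension less. -/
theorem sum_gridFace_pathSum {l : ι → (ι → ℕ) → ZMod 2} {p : ℕ}
    (h0 : ∀ i x, x i = 0 → l i x = 0) (hp : ∀ i x, x i = p → l i x = 1) {L : List ι}
    (hL : L.Nodup) : ∑ v ∈ gridFace p L, pathSum l L L.toFinset v = 1 := by
  induction L with
  | nil => simp [pathSum, gridFace]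
  | cons i L ih =>
    obtain ⟨hi, hL⟩ := List.nodup_cons.1 hL
    have hcard : (i :: L).toFinset.card = L.length + 1 := by
      rw [List.toFinset_card_of_nodup (List.nodup_cons.2 ⟨hi, hL⟩)]; rfl
    set A := (i :: L).toFinset with hA
    have hAi : A.erase i = L.toFinset := by
      rw [hA, List.toFinset_cons, Finset.erase_insert (by simpa using hi)]
    have h1 : ∀ v, pathSum l (i :: L) A v
        = ∑ j ∈ A, (l i (latticeStep v j) * pathSum l L (A.erase j) (latticeStep v j)
          - l i v * pathSum l L (A.erase j) v) := by
      intro v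
      rw [Finset.sum_sub_distrib, ← Finset.mul_sum, ← pathSum_stokes l L A v hcard,
        Finset.mul_sum, ← Finset.sum_sub_distrib]
      simp only [pathSum, sub_mul]
    rw [Finset.sum_congr rfl fun v _ => h1 v, Finset.sum_comm,
      Finset.sum_eq_single_of_mem i (by simp [hA])]
    · rw [sum_telescope_single p (by simp) (fun v => l i v * pathSum l L (A.erase i) v)]
      have hf : (i :: L).filter (· ≠ i) = L := by
        simp only [ne_eq, decide_not, List.filter_cons, decide_true, Bool.not_true,
          Bool.false_eq_true, if_false]
        exact List.filter_eq_self.2 fun a ha => by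
          have : a ≠ i := fun h => hi (h ▸ ha)
          simp [this]
      rw [hf, ← ih hL]
      refine Finset.sum_congr rfl fun v hv => ?_
      have hvi : v i = p := by simpa [hi] using (Fintype.mem_piFinset.1 hv) i
      rw [hp i v hvi, h0 i (Function.update v i 0) (by simp), hAi]
      simp
    · intro j hjA hji
      have hjL : j ∈ L := by
        have : j ∈ i :: L := by simpa [hA] using hjA
        simpa [hji] using this
      rw [sum_telescope_single p (by simp [hjL])
        (fun v => l i v * pathSum l L (A.erase j) v)]
      refine Finset.sum_eq_zero fun v hv => ?_
      have hvj : v j = p := by simpa using (Fintype.mem_piFinset.1 hv) j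
      rw [pathSum_eq_zero_of_face (c := p) (fun x y hx hy => by rw [hp j x hx, hp j y hy]) hjL
        (by simp) hvj, pathSum_eq_zero_of_face (c := 0)
        (fun x y hx hy => by rw [h0 j x hx, h0 j y hy]) hjL (by simp) (by simp)]
      simp

/-- Kuhn's cubical lemma: labels which are `0` on lower faces and `1` on upper faces all change
their values on some common unit cube. -/
theorem exists_unit_cube_of_labels {l : ι → (ι → ℕ) → ZMod 2} {p : ℕ}
    (h0 : ∀ i x, x i = 0 → l i x = 0) (hp : ∀ i x, x i = p → l i x = 1) :
    ∃ v : ι → ℕ, (∀ i, v i < p) ∧ ∀ i, ∃ y z : ι → ℕ,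
      (∀ k, v k ≤ y k ∧ y k ≤ v k + 1) ∧ (∀ k, v k ≤ z k ∧ z k ≤ v k + 1) ∧ l i y ≠ l i z := by
  have hs := sum_gridFace_pathSum h0 hp (Finset.nodup_toList (Finset.univ : Finset ι))
  obtain ⟨v, hv, hne⟩ := Finset.exists_ne_zero_of_sum_ne_zero (hs.trans_ne one_ne_zero)
  refine ⟨v, fun i => by simpa using (Fintype.mem_piFinset.1 hv) i, fun i => ?_⟩
  simpa using exists_ne_of_pathSum_ne_zero hne i (by simp)

/-- The **Poincaré–Miranda theorem**. -/
theorem exists_zero_of_sign_on_faces {a b : ι → ℝ} (hab : ∀ i, a i ≤ b i)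
    {F : (ι → ℝ) → ι → ℝ} (hF : ContinuousOn F (Icc a b))
    (ha : ∀ i, ∀ x ∈ Icc a b, x i = a i → F x i ≤ 0)
    (hb : ∀ i, ∀ x ∈ Icc a b, x i = b i → 0 ≤ F x i) :
    ∃ x ∈ Icc a b, F x = 0 := by
  classical
  -- The truncation by `min` keeps every lattice point inside the box, since labels are needed on
  -- all of `ι → ℕ`.
  let g : ℕ → (ι → ℕ) → ι → ℝ := fun p x i => a i + (b i - a i) * (min (x i : ℝ) p / p)
  have hg : ∀ p x, g p x ∈ Icc a b := by
    intro p x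
    have h1 : ∀ i, 0 ≤ (min (x i : ℝ) p / p) ∧ (min (x i : ℝ) p / p) ≤ 1 := fun i =>
      ⟨by positivity, div_le_one_of_le₀ (min_le_right _ _) (by positivity)⟩
    refine ⟨fun i => ?_, fun i => ?_⟩
    · have := mul_nonneg (sub_nonneg.2 (hab i)) (h1 i).1
      simp only [g]; linarith
    · have := mul_le_mul_of_nonneg_left (h1 i).2 (sub_nonneg.2 (hab i))
      simp only [g]; linarith
  have cube : ∀ n : ℕ, ∃ v : ι → ℝ, v ∈ Icc a b ∧ ∀ i, ∃ y z : ι → ℝ, y ∈ Icc a b ∧ z ∈ Icc a b ∧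
      (∀ k, |y k - v k| ≤ (b k - a k) * (1 / (n + 1 : ℝ))) ∧
      (∀ k, |z k - v k| ≤ (b k - a k) * (1 / (n + 1 : ℝ))) ∧
      F y i ≤ 0 ∧ 0 ≤ F z i := by
    intro n
    set p := n + 1 with hpn
    have hp0 : (0 : ℝ) < p := by rw [hpn]; positivity
    -- Boundary labels are prescribed before the sign is tested: on the upper face `F` may vanish,
    -- and the sign alone would give the wrong label.
    let l : ι → (ι → ℕ) → ZMod 2 := fun i x =>
      if x i = 0 then 0 else if x i = p then 1 else if F (g p x) i ≤ 0 then 0 else 1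
    have hl0 : ∀ i x, l i x = 0 → F (g p x) i ≤ 0 := by
      intro i x h
      by_cases h1 : x i = 0
      · exact ha i _ (hg p x) (by simp [g, h1])
      · by_contra h2
        by_cases h3 : x i = p <;> simp [l, h1, h3, h2] at h
    have hl1 : ∀ i x, l i x = 1 → 0 ≤ F (g p x) i := by
      intro i x h
      by_cases h1 : x i = 0
      · simp [l, h1] at h
      by_cases h3 : x i = p
      · refine hb i _ (hg p x) ?_
        simp [g, h3]
      · by_contra h2
        simp [l, h1, h3, (not_le.1 h2).le] at h
    obtain ⟨v, hvp, hv⟩ := exists_unit_cube_of_labels (l := l) (p := p)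
      (fun i x h => by simp [l, h]) (fun i x h => by simp [l, h, hpn])
    have hclose : ∀ w : ι → ℕ, (∀ k, v k ≤ w k ∧ w k ≤ v k + 1) →
        ∀ k, |g p w k - g p v k| ≤ (b k - a k) * (1 / (n + 1 : ℝ)) := by
      intro w hw k
      have hwp : w k ≤ p := (hw k).2.trans (hvp k)
      have h1 : g p w k - g p v k = (b k - a k) * ((w k - v k : ℝ) / p) := by
        simp only [g]
        rw [min_eq_left (by exact_mod_cast hwp), min_eq_left (by exact_mod_cast (hvp k).le)]
        ring
      have h2 : (v k : ℝ) ≤ w k := by exact_mod_cast (hw k).1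
      have h3 : (w k : ℝ) ≤ v k + 1 := by exact_mod_cast (hw k).2
      have h4 : 0 ≤ (w k - v k : ℝ) / p := div_nonneg (by linarith) hp0.le
      rw [h1, abs_of_nonneg (mul_nonneg (sub_nonneg.2 (hab k)) h4)]
      refine mul_le_mul_of_nonneg_left ?_ (sub_nonneg.2 (hab k))
      have : (n + 1 : ℝ) = p := by rw [hpn]; push_cast; rfl
      rw [this]
      exact div_le_div_of_nonneg_right (by linarith) hp0.le
    refine ⟨g p v, hg p v, fun i => ?_⟩
    obtain ⟨y, z, hy, hz, hyz⟩ := hv i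
    have h01 : ∀ x, l i x = 0 ∨ l i x = 1 := by
      intro x; simp only [l]; split_ifs <;> simp
    rcases h01 y with h | h
    · have h' : l i z = 1 := (h01 z).resolve_left fun h'' => hyz (h.trans h''.symm)
      exact ⟨g p y, g p z, hg p y, hg p z, hclose y hy, hclose z hz, hl0 i y h, hl1 i z h'⟩
    · have h' : l i z = 0 := (h01 z).resolve_right fun h'' => hyz (h.trans h''.symm)
      exact ⟨g p z, g p y, hg p z, hg p y, hclose z hz, hclose y hy, hl0 i z h', hl1 i y h⟩
  choose v hv hcube using cube
  obtain ⟨x, hx, φ, hφ, hlim⟩ := isCompact_Icc.tendsto_subseq hv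
  have hsmall : ∀ k, Tendsto (fun n => (b k - a k) * (1 / (φ n + 1 : ℝ))) atTop (𝓝 0) := by
    intro k
    simpa using (tendsto_one_div_add_atTop_nhds_zero_nat.comp hφ.tendsto_atTop).const_mul (b k - a k)
  have hconv : ∀ w : ℕ → ι → ℝ, (∀ n k, |w n k - v (φ n) k| ≤ (b k - a k) * (1 / (φ n + 1 : ℝ))) →
      Tendsto w atTop (𝓝 x) := by
    intro w hw
    rw [tendsto_pi_nhds] at hlim ⊢
    intro k
    have h1 : Tendsto (fun n => w n k - v (φ n) k) atTop (𝓝 0) :=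
      squeeze_zero_norm (fun n => hw n k) (hsmall k)
    simpa using h1.add (hlim k)
  refine ⟨x, hx, ?_⟩
  ext i
  choose y z hy hz hyv hzv hFy hFz using fun n => hcube (φ n) i
  have hFt : ∀ w : ℕ → ι → ℝ, (∀ n, w n ∈ Icc a b) → Tendsto w atTop (𝓝 x) →
      Tendsto (fun n => F (w n) i) atTop (𝓝 (F x i)) := by
    intro w hw hwx
    have := (hF x hx).tendsto.comp (tendsto_nhdsWithin_iff.2 ⟨hwx, Eventually.of_forall hw⟩)
    exact (tendsto_pi_nhds.1 this) i
  exact le_antisymm (le_of_tendsto' (hFt y hy (hconv y hyv)) hFy)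
    (ge_of_tendsto' (hFt z hz (hconv z hzv)) hFz)

end Miranda

/-! ### The Prüfer angle of a second-order linear equation -/

section Prufer

open Real

/-- `θ` solves the Prüfer equation `θ' = cos² θ + c sin² θ` on `[0, 4]`. -/
def IsPruferAngle (c θ : ℝ → ℝ) : Prop :=
  ∀ x ∈ Icc (0 : ℝ) 4, HasDerivWithinAt θ (cos (θ x) ^ 2 + c x * sin (θ x) ^ 2) (Icc 0 4) x

theorem IsPruferAngle.continuousOn {c θ : ℝ → ℝ} (h : IsPruferAngle c θ) :
    ContinuousOn θ (Icc 0 4) :=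
  fun x hx => (h x hx).continuousWithinAt

theorem hasDerivWithinAt_Ici_of_Icc {f : ℝ → ℝ} {f' a b x : ℝ} (hx : x ∈ Ico a b)
    (h : HasDerivWithinAt f f' (Icc a b) x) : HasDerivWithinAt f f' (Ici x) x :=
  h.mono_of_mem_nhdsWithin (Icc_mem_nhdsGE_of_mem hx)

theorem abs_sin_sq_sub_sin_sq_le (a b : ℝ) : |sin a ^ 2 - sin b ^ 2| ≤ |a - b| := by
  have h : sin a ^ 2 - sin b ^ 2 = sin (a - b) * sin (a + b) := by
    rw [sin_sub, sin_add]
    have h1 := sin_sq_add_cos_sq a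
    have h2 := sin_sq_add_cos_sq b
    linear_combination (sin b) ^ 2 * h1 - (sin a) ^ 2 * h2
  rw [h, abs_mul]
  calc |sin (a - b)| * |sin (a + b)| ≤ |a - b| * 1 :=
        mul_le_mul abs_sin_le_abs (abs_sin_le_one _) (abs_nonneg _) (abs_nonneg _)
    _ = |a - b| := mul_one _

theorem lipschitzWith_prufer {c : ℝ} {K : NNReal} (hc : |c| ≤ K) :
    LipschitzWith (K + 1) fun θ : ℝ => cos θ ^ 2 + c * sin θ ^ 2 := by
  refine LipschitzWith.of_dist_le_mul fun a b => ?_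
  rw [Real.dist_eq, Real.dist_eq]
  have h : cos a ^ 2 + c * sin a ^ 2 - (cos b ^ 2 + c * sin b ^ 2)
      = (c - 1) * (sin a ^ 2 - sin b ^ 2) := by
    rw [cos_sq', cos_sq']; ring
  rw [h, abs_mul]
  refine mul_le_mul ?_ (abs_sin_sq_sub_sin_sq_le a b) (abs_nonneg _) (by positivity)
  calc |c - 1| ≤ |c| + |1| := abs_sub _ _
    _ ≤ _ := by push_cast; rw [abs_one]; linarith

theorem exists_isPruferAngle {c : ℝ → ℝ} (hc : Continuous c) {K : NNReal}
    (hK : ∀ x ∈ Icc (0 : ℝ) 4, |c x| ≤ K) (θ₀ : ℝ) : ∃ θ, θ 0 = θ₀ ∧ IsPruferAngle c θ := by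
  -- The speed is at most `1 + K`, so a solution cannot leave the ball of radius `(1 + K) * 4`
  -- during time `4`: existence is global.
  have hpl : IsPicardLindelof (fun x θ : ℝ => cos θ ^ 2 + c x * sin θ ^ 2)
      (tmin := 0) (tmax := 4) ⟨0, by norm_num⟩ θ₀ ((1 + K) * 4) 0 (1 + K) (K + 1) := by
    refine ⟨fun t ht => (lipschitzWith_prufer (hK t ht)).lipschitzOnWith, fun x _ => ?_,
      fun t ht x _ => ?_, ?_⟩
    · fun_prop
    · rw [Real.norm_eq_abs]
      calc |cos x ^ 2 + c t * sin x ^ 2| ≤ |cos x ^ 2| + |c t * sin x ^ 2| := abs_add_le _ _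
        _ ≤ 1 + K := by
          rw [abs_mul, abs_of_nonneg (sq_nonneg (cos x)), abs_of_nonneg (sq_nonneg (sin x))]
          refine add_le_add (cos_sq_le_one x) ?_
          calc |c t| * sin x ^ 2 ≤ K * 1 :=
                mul_le_mul (hK t ht) (sin_sq_le_one x) (sq_nonneg _) K.2
            _ = K := mul_one _
        _ = _ := by push_cast; ring
    · norm_num
  exact hpl.exists_eq_forall_mem_Icc_hasDerivWithinAt₀

theorem IsPruferAngle.dist_le {c₁ c₂ θ₁ θ₂ : ℝ → ℝ} (h₁ : IsPruferAngle c₁ θ₁)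
    (h₂ : IsPruferAngle c₂ θ₂) {K : NNReal} (hK : ∀ x ∈ Icc (0 : ℝ) 4, |c₁ x| ≤ K) {ε δ : ℝ}
    (hc : ∀ x ∈ Icc (0 : ℝ) 4, |c₂ x - c₁ x| ≤ ε) (h0 : |θ₁ 0 - θ₂ 0| ≤ δ) :
    ∀ x ∈ Icc (0 : ℝ) 4, |θ₁ x - θ₂ x| ≤ gronwallBound δ (K + 1) ε x := by
  intro x hx
  have := dist_le_of_approx_trajectories_ODE_of_mem (K := K + 1) (s := fun _ => univ) (δ := δ)
    (εf := 0) (εg := ε) (v := fun x θ : ℝ => cos θ ^ 2 + c₁ x * sin θ ^ 2)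
    (fun t ht => (lipschitzWith_prufer (hK t (Ico_subset_Icc_self ht))).lipschitzOnWith)
    h₁.continuousOn
    (fun t ht => hasDerivWithinAt_Ici_of_Icc ht (h₁ t (Ico_subset_Icc_self ht)))
    (fun t _ => by rw [dist_self]) (fun _ _ => trivial) h₂.continuousOn
    (fun t ht => hasDerivWithinAt_Ici_of_Icc ht (h₂ t (Ico_subset_Icc_self ht)))
    (fun t ht => ?_) (fun _ _ => trivial) (by rwa [Real.dist_eq]) x hx
  · simpa [Real.dist_eq] using this
  · rw [Real.dist_eq]
    have : cos (θ₂ t) ^ 2 + c₂ t * sin (θ₂ t) ^ 2 - (cos (θ₂ t) ^ 2 + c₁ t * sin (θ₂ t) ^ 2)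
        = (c₂ t - c₁ t) * sin (θ₂ t) ^ 2 := by ring
    rw [this, abs_mul, abs_of_nonneg (sq_nonneg (sin _))]
    calc |c₂ t - c₁ t| * sin (θ₂ t) ^ 2 ≤ |c₂ t - c₁ t| * 1 :=
          mul_le_mul_of_nonneg_left (sin_sq_le_one _) (abs_nonneg _)
      _ ≤ ε := by rw [mul_one]; exact hc t (Ico_subset_Icc_self ht)

/-- A Prüfer angle cannot cross a multiple of `π` downwards. -/
theorem IsPruferAngle.le_of_le {c θ : ℝ → ℝ} (h : IsPruferAngle c θ) {K : ℝ} (hK0 : 0 ≤ K)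
    (hK : ∀ x ∈ Icc (0 : ℝ) 4, |c x| ≤ K) {n : ℕ} {η x₀ x : ℝ} (hη : 0 ≤ η) (hx₀ : 0 ≤ x₀)
    (hx : x₀ ≤ x) (hx4 : x ≤ 4) (h0 : n * π + η ≤ θ x₀) :
    n * π + η * exp (-((K + 1) * (x - x₀))) ≤ θ x := by
  have hsub : Icc x₀ 4 ⊆ Icc 0 4 := Icc_subset_Icc_left hx₀
  have := image_le_of_deriv_right_lt_deriv_boundary' (a := x₀) (b := 4)
    (f := fun y => n * π + η * exp (-((K + 1) * (y - x₀))))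
    (f' := fun y => η * (exp (-((K + 1) * (y - x₀))) * -((K + 1) * 1))) (B := θ)
    (B' := fun y => cos (θ y) ^ 2 + c y * sin (θ y) ^ 2) (by fun_prop)
    (fun y _ => (((((hasDerivAt_id y).sub_const x₀).const_mul (K + 1)).neg.exp.const_mul η).const_add
      (n * π)).hasDerivWithinAt) (by simpa using h0) (h.continuousOn.mono hsub)
    (fun y hy => hasDerivWithinAt_Ici_of_Icc ⟨hx₀.trans hy.1, hy.2⟩
      (h y (hsub (Ico_subset_Icc_self hy)))) (fun y hy he => ?_) ⟨hx, hx4⟩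
  · exact this
  · set z := η * exp (-((K + 1) * (y - x₀))) with hz
    have hz0 : 0 ≤ z := by positivity
    have hc1 : cos (θ y) ^ 2 = 1 - sin z ^ 2 := by
      rw [← cos_sq', ← he, add_comm]
      rw [cos_add_nat_mul_pi, mul_pow, ← pow_mul, mul_comm n 2, pow_mul]; simp
    have hs1 : sin (θ y) ^ 2 = sin z ^ 2 := by
      rw [sin_sq, hc1]; ring
    have hs2 : sin z ^ 2 ≤ z := by
      calc sin z ^ 2 = |sin z| * |sin z| := by rw [← sq, sq_abs]
        _ ≤ |z| * 1 := mul_le_mul abs_sin_le_abs (abs_sin_le_one _) (abs_nonneg _) (abs_nonneg _)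
        _ = z := by rw [mul_one, abs_of_nonneg hz0]
    have hcK := abs_le.1 (hK y (hsub (Ico_subset_Icc_self hy)))
    have h3 : -K * sin z ^ 2 ≤ c y * sin z ^ 2 :=
      mul_le_mul_of_nonneg_right hcK.1 (sq_nonneg _)
    have h4 : (K + 1) * sin z ^ 2 ≤ (K + 1) * z := mul_le_mul_of_nonneg_left hs2 (by linarith)
    have h5 : η * (exp (-((K + 1) * (y - x₀))) * -((K + 1) * 1)) = -((K + 1) * z) := by
      rw [hz]; ring
    rw [h5, hc1, hs1]
    linarith

/-- The solution of `u'' + c u = 0` with a given Prüfer angle. -/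
theorem IsPruferAngle.exists_amplitude {c θ : ℝ → ℝ} (hc : Continuous c)
    (h : IsPruferAngle c θ) : ∃ r : ℝ → ℝ, (∀ x, 0 < r x) ∧ ∀ x ∈ Icc (0 : ℝ) 4,
      HasDerivWithinAt (fun x => r x * sin (θ x)) (r x * cos (θ x)) (Icc 0 4) x ∧
      HasDerivWithinAt (fun x => r x * cos (θ x)) (-(c x * (r x * sin (θ x)))) (Icc 0 4) x := by
  have h04 : (0 : ℝ) ≤ 4 := by norm_num
  -- The continuous extension lets the fundamental theorem of calculus be used at the end points
  -- too.
  set θe := IccExtend h04 ((Icc 0 4).domRestrict θ) with hθe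
  have hθc : Continuous θe := (continuousOn_iff_continuous_domRestrict.1 h.continuousOn).Icc_extend'
  have hθeq : ∀ x ∈ Icc (0 : ℝ) 4, θe x = θ x := fun x hx => by
    rw [hθe, IccExtend_of_mem _ _ hx]; rfl
  -- This is the logarithmic derivative `r' / r` forced by `(r sin θ)' = r cos θ`.
  set g : ℝ → ℝ := fun x => (1 - c x) * (sin (θe x) * cos (θe x)) with hg
  have hgc : Continuous g := by fun_prop
  refine ⟨fun x => exp (∫ y in (0 : ℝ)..x, g y), fun x => exp_pos _, fun x hx => ?_⟩
  have hr : HasDerivWithinAt (fun x => exp (∫ y in (0 : ℝ)..x, g y))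
      (exp (∫ y in (0 : ℝ)..x, g y) * g x) (Icc 0 4) x :=
    (hgc.integral_hasStrictDerivAt 0 x).hasDerivAt.exp.hasDerivWithinAt
  have hgx : g x = (1 - c x) * (sin (θ x) * cos (θ x)) := by simp only [hg, hθeq x hx]
  have hsc := sin_sq_add_cos_sq (θ x)
  constructor
  · refine (hr.mul (h x hx).sin).congr_deriv ?_
    rw [hgx]
    linear_combination exp (∫ y in (0 : ℝ)..x, g y) * cos (θ x) * hsc
  · refine (hr.mul (h x hx).cos).congr_deriv ?_
    rw [hgx]
    linear_combination -exp (∫ y in (0 : ℝ)..x, g y) * c x * sin (θ x) * hsc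

/-- With `u = r sin θ` and `u' = r cos θ`, the cotangent is `u' / u`, which satisfies the Riccati
equation; this makes it the right weight in `IsTest.riccati`. -/
theorem IsPruferAngle.hasDerivWithinAt_cot {c θ : ℝ → ℝ} (h : IsPruferAngle c θ) {x : ℝ}
    (hx : x ∈ Icc (0 : ℝ) 4) (hs : sin (θ x) ≠ 0) :
    HasDerivWithinAt (fun x => cos (θ x) / sin (θ x)) (-(cos (θ x) / sin (θ x)) ^ 2 - c x)
      (Icc 0 4) x := by
  refine ((h x hx).cos.div (h x hx).sin hs).congr_deriv ?_
  have hsc := sin_sq_add_cos_sq (θ x)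
  field_simp
  linear_combination (-(cos (θ x)) ^ 2 - c x * sin (θ x) ^ 2) * hsc

end Prufer

/-! ### Variational characterization of the first Dirichlet eigenvalue -/

noncomputable section Eigenvalue

open Real

/-- `f` is a `C¹` function on `[a, b] ⊆ [0, 4]` with derivative `f'` vanishing at `a` and `b`. -/
structure IsTest (a b : ℝ) (f f' : ℝ → ℝ) : Prop where
  nonneg : 0 ≤ a
  lt : a < b
  le_four : b ≤ 4
  hasDeriv : ∀ x ∈ Icc a b, HasDerivWithinAt f (f' x) (Icc a b) x
  cont_deriv : ContinuousOn f' (Icc a b)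
  left : f a = 0
  right : f b = 0

namespace IsTest

variable {a b : ℝ} {f f' : ℝ → ℝ}

theorem cont (h : IsTest a b f f') : ContinuousOn f (Icc a b) :=
  fun x hx => (h.hasDeriv x hx).continuousWithinAt

theorem subset (h : IsTest a b f f') : Icc a b ⊆ Icc 0 4 := Icc_subset_Icc h.nonneg h.le_four

theorem intervalIntegrable (h : IsTest a b f f') {g : ℝ → ℝ} (hg : ContinuousOn g (Icc a b)) :
    IntervalIntegrable g MeasureTheory.volume a b := by
  rw [← uIcc_of_le h.lt.le] at hg
  exact hg.intervalIntegrable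

theorem integral_deriv (h : IsTest a b f f') {g g' : ℝ → ℝ}
    (hg : ∀ x ∈ Icc a b, HasDerivWithinAt g (g' x) (Icc a b) x) (hg' : ContinuousOn g' (Icc a b)) :
    ∫ x in a..b, g' x = g b - g a :=
  intervalIntegral.integral_eq_sub_of_hasDerivAt_of_le h.lt.le
    (fun x hx => (hg x hx).continuousWithinAt)
    (fun x hx => (hg x (Ioo_subset_Icc_self hx)).hasDerivAt (Icc_mem_nhds hx.1 hx.2))
    (h.intervalIntegrable hg')

/-- A Riccati (Jacobi) lower bound for the Dirichlet integral. -/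
theorem riccati (h : IsTest a b f f') {w w' : ℝ → ℝ}
    (hw : ∀ x ∈ Icc a b, HasDerivWithinAt w (w' x) (Icc a b) x) (hw' : ContinuousOn w' (Icc a b)) :
    ∫ x in a..b, -(w' x + w x ^ 2) * f x ^ 2 ≤ ∫ x in a..b, f' x ^ 2 := by
  have hwc : ContinuousOn w (Icc a b) := fun x hx => (hw x hx).continuousWithinAt
  have hf := h.cont
  have hf' := h.cont_deriv
  have h1 : ∫ x in a..b, (w' x * f x ^ 2 + w x * (2 * f x * f' x)) = 0 := by
    rw [h.integral_deriv (g := fun x => w x * f x ^ 2) (fun x hx => ?_) (by fun_prop), h.left,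
      h.right]
    · simp
    · refine ((hw x hx).mul ((h.hasDeriv x hx).pow 2)).congr_deriv ?_
      simp
  -- Jacobi's trick: expanding this square produces the claim up to the total derivative of `w f²`,
  -- whose integral vanishes.
  have h2 : 0 ≤ ∫ x in a..b, (f' x - w x * f x) ^ 2 :=
    intervalIntegral.integral_nonneg h.lt.le fun _ _ => sq_nonneg _
  have h3 : ∀ x, (f' x - w x * f x) ^ 2 = f' x ^ 2 - -(w' x + w x ^ 2) * f x ^ 2
      - (w' x * f x ^ 2 + w x * (2 * f x * f' x)) := fun x => by ring
  simp only [h3] at h2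
  rw [intervalIntegral.integral_sub (h.intervalIntegrable (by fun_prop))
    (h.intervalIntegrable (by fun_prop)), intervalIntegral.integral_sub
    (h.intervalIntegrable (by fun_prop)) (h.intervalIntegrable (by fun_prop)), h1] at h2
  linarith

theorem integral_deriv_sq (h : IsTest a b f f') {c : ℝ → ℝ} (hc : ContinuousOn c (Icc a b))
    (hf'' : ∀ x ∈ Icc a b, HasDerivWithinAt f' (-(c x * f x)) (Icc a b) x) :
    ∫ x in a..b, f' x ^ 2 = ∫ x in a..b, c x * f x ^ 2 := by
  have hf := h.cont
  have hf' := h.cont_deriv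
  have h1 : ∫ x in a..b, (f' x ^ 2 - c x * f x ^ 2) = 0 := by
    rw [h.integral_deriv (g := fun x => f x * f' x) (fun x hx => ?_) (by fun_prop), h.left, h.right]
    · simp
    · refine ((h.hasDeriv x hx).mul (hf'' x hx)).congr_deriv ?_
      ring
  rw [intervalIntegral.integral_sub (h.intervalIntegrable (by fun_prop))
    (h.intervalIntegrable (by fun_prop))] at h1
  linarith

theorem integral_sq_nonneg (h : IsTest a b f f') : 0 ≤ ∫ x in a..b, f x ^ 2 :=
  intervalIntegral.integral_nonneg h.lt.le fun _ _ => sq_nonneg _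

/-- A Hardy-type inequality: the weight `w = 1 / (2 (x + 1))` has `-(w' + w²) = 1 / (4 (x + 1)²)`,
which is at least `1 / 100` because `x + 1 ≤ 5`. -/
theorem poincare (h : IsTest a b f f') :
    1 / 100 * ∫ x in a..b, f x ^ 2 ≤ ∫ x in a..b, f' x ^ 2 := by
  have hpos : ∀ x ∈ Icc a b, 0 < x + 1 := fun x hx => by
    have := (h.subset hx).1; linarith
  have hf := h.cont
  have hcont : ContinuousOn (fun x : ℝ => -(1 / (2 * (x + 1) ^ 2))) (Icc a b) := by
    refine ContinuousOn.neg (ContinuousOn.div (by fun_prop) (by fun_prop) fun x hx => ?_)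
    have := hpos x hx
    positivity
  have hcont2 : ContinuousOn (fun x : ℝ => 1 / (2 * (x + 1))) (Icc a b) := by
    refine ContinuousOn.div (by fun_prop) (by fun_prop) fun x hx => ?_
    have := hpos x hx
    positivity
  have := h.riccati (w := fun x => 1 / (2 * (x + 1))) (w' := fun x => -(1 / (2 * (x + 1) ^ 2)))
    (fun x hx => ?_) hcont
  · refine le_trans ?_ this
    rw [← intervalIntegral.integral_const_mul]
    refine intervalIntegral.integral_mono_on h.lt.le (h.intervalIntegrable (by fun_prop))
      (h.intervalIntegrable (by fun_prop)) fun x hx => ?_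
    refine mul_le_mul_of_nonneg_right ?_ (sq_nonneg _)
    have h1 := hpos x hx
    have h2 := (h.subset hx).2
    have h3 : -(-(1 / (2 * (x + 1) ^ 2)) + (1 / (2 * (x + 1))) ^ 2) = 1 / (4 * (x + 1) ^ 2) := by
      field_simp; ring
    rw [h3]
    refine one_div_le_one_div_of_le (by positivity) ?_
    nlinarith
  · have h1 := hpos x hx
    have := ((((hasDerivAt_id x).add_const 1).const_mul 2).inv (by simpa using h1.ne'))
    simp only [one_div]
    refine (this.congr_deriv ?_).hasDerivWithinAt
    simp only [id]
    field_simp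

end IsTest

/-- The numbers `l` with `l ∫ Q f² ≤ ∫ (f'² + m² f²)` for all test functions `f`. -/
def lowerLevels (Q : ℝ → ℝ) (m : ℝ) : Set ℝ :=
  {l | ∀ a b f f', IsTest a b f f' →
    l * ∫ x in a..b, Q x * f x ^ 2 ≤ (∫ x in a..b, f' x ^ 2) + m ^ 2 * ∫ x in a..b, f x ^ 2}

/-- The variational first Dirichlet eigenvalue. -/
def groundLevel (Q : ℝ → ℝ) (m : ℝ) : ℝ := sSup (lowerLevels Q m)

variable {Q : ℝ → ℝ} {m : ℝ}

theorem zero_mem_lowerLevels : 0 ∈ lowerLevels Q m := by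
  intro a b f f' h
  rw [zero_mul]
  exact add_nonneg (intervalIntegral.integral_nonneg h.lt.le fun _ _ => sq_nonneg _)
    (mul_nonneg (sq_nonneg _) h.integral_sq_nonneg)

/-- Test with half a sine wave on `[2 - δ, 2 + δ]`, whose frequency is `π / (2δ)`. -/
theorem mul_le_of_mem_lowerLevels (hQc : Continuous Q) {l c δ : ℝ} (hl : l ∈ lowerLevels Q m)
    (hl0 : 0 ≤ l) (hδ : 0 < δ) (hδ2 : δ ≤ 2) (hQ : ∀ x ∈ Icc (2 - δ) (2 + δ), c ≤ Q x) :
    l * c ≤ m ^ 2 + (π / (2 * δ)) ^ 2 := by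
  set k := π / (2 * δ) with hk
  have hk0 : 0 < k := by positivity
  have hkd : k * (2 + δ - (2 - δ)) = π := by rw [hk]; field_simp; ring
  have hsd : ∀ x, HasDerivAt (fun x => sin (k * (x - (2 - δ)))) (k * cos (k * (x - (2 - δ)))) x :=
    fun x => (((hasDerivAt_id x).sub_const (2 - δ)).const_mul k).sin.congr_deriv (by simp; ring)
  have hcd : ∀ x, HasDerivAt (fun x => k * cos (k * (x - (2 - δ))))
      (-(k ^ 2 * sin (k * (x - (2 - δ))))) x :=
    fun x => ((((hasDerivAt_id x).sub_const (2 - δ)).const_mul k).cos.const_mul k).congr_deriv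
      (by simp; ring)
  have ht : IsTest (2 - δ) (2 + δ) (fun x => sin (k * (x - (2 - δ))))
      (fun x => k * cos (k * (x - (2 - δ)))) :=
    ⟨by linarith, by linarith, by linarith, fun x _ => (hsd x).hasDerivWithinAt, by fun_prop,
      by simp, by simp only [hkd, sin_pi]⟩
  have h1 := ht.integral_deriv_sq (c := fun _ => k ^ 2) (by fun_prop)
    (fun x _ => (hcd x).hasDerivWithinAt)
  rw [intervalIntegral.integral_const_mul] at h1
  have h2 := hl _ _ _ _ ht
  have h3 : c * ∫ x in (2 - δ)..(2 + δ), sin (k * (x - (2 - δ))) ^ 2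
      ≤ ∫ x in (2 - δ)..(2 + δ), Q x * sin (k * (x - (2 - δ))) ^ 2 := by
    rw [← intervalIntegral.integral_const_mul]
    exact intervalIntegral.integral_mono_on ht.lt.le (ht.intervalIntegrable (by fun_prop))
      (ht.intervalIntegrable (by fun_prop))
      fun x hx => mul_le_mul_of_nonneg_right (hQ x hx) (sq_nonneg _)
  have h4 : 0 < ∫ x in (2 - δ)..(2 + δ), sin (k * (x - (2 - δ))) ^ 2 := by
    refine intervalIntegral.integral_pos ht.lt (by fun_prop) (fun _ _ => sq_nonneg _)
      ⟨2, ⟨by linarith, by linarith⟩, ?_⟩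
    have : k * (2 - (2 - δ)) = π / 2 := by rw [hk]; field_simp; ring
    rw [this]; simp
  have h5 := mul_le_mul_of_nonneg_left h3 hl0
  beta_reduce at h2 h1
  rw [h1, ← add_mul] at h2
  rw [← mul_assoc] at h5
  have := le_of_mul_le_mul_right (h5.trans h2) h4
  linarith

theorem bddAbove_lowerLevels (hQc : Continuous Q) (hQ : ∀ x, 0 < Q x) :
    BddAbove (lowerLevels Q m) := by
  obtain ⟨x₀, _, hx₀⟩ := (isCompact_Icc (a := (0 : ℝ)) (b := 4)).exists_isMinOn
    (nonempty_Icc.2 (by norm_num)) hQc.continuousOn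
  refine ⟨(m ^ 2 + (π / (2 * 2)) ^ 2) / Q x₀, fun l hl => ?_⟩
  have h0 := hQ x₀
  by_cases hl0 : 0 ≤ l
  · rw [le_div_iff₀ h0]
    refine mul_le_of_mem_lowerLevels hQc hl hl0 two_pos le_rfl fun x hx => hx₀ ?_
    constructor <;> [linarith [hx.1]; linarith [hx.2]]
  · exact (not_le.1 hl0).le.trans (by positivity)

theorem groundLevel_nonneg (hQc : Continuous Q) (hQ : ∀ x, 0 < Q x) : 0 ≤ groundLevel Q m :=
  le_csSup (bddAbove_lowerLevels hQc hQ) zero_mem_lowerLevels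

theorem integral_weight_nonneg (hQ : ∀ x, 0 < Q x) {a b : ℝ} {f f' : ℝ → ℝ} (h : IsTest a b f f') :
    0 ≤ ∫ x in a..b, Q x * f x ^ 2 :=
  intervalIntegral.integral_nonneg h.lt.le fun x _ => mul_nonneg (hQ x).le (sq_nonneg _)

theorem groundLevel_mem (hQ : ∀ x, 0 < Q x) :
    groundLevel Q m ∈ lowerLevels Q m := by
  intro a b f f' h
  rcases (integral_weight_nonneg hQ h).eq_or_lt with h0 | h0
  · have := zero_mem_lowerLevels (Q := Q) (m := m) a b f f' h
    rw [← h0, mul_zero]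
    rwa [zero_mul] at this
  · rw [← le_div_iff₀ h0]
    exact csSup_le ⟨0, zero_mem_lowerLevels⟩ fun l hl => (le_div_iff₀ h0).2 (hl a b f f' h)

theorem groundLevel_mul_le (hQc : Continuous Q) (hQ : ∀ x, 0 < Q x) {c δ : ℝ} (hδ : 0 < δ)
    (hδ2 : δ ≤ 2) (hc : ∀ x ∈ Icc (2 - δ) (2 + δ), c ≤ Q x) :
    groundLevel Q m * c ≤ m ^ 2 + (π / (2 * δ)) ^ 2 :=
  mul_le_of_mem_lowerLevels hQc (groundLevel_mem hQ) (groundLevel_nonneg hQc hQ) hδ hδ2 hc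

theorem le_groundLevel_mul (hQc : Continuous Q) (hQ : ∀ x, 0 < Q x) {K : ℝ}
    (hK : ∀ x, Q x ≤ K) : m ^ 2 + 1 / 100 ≤ groundLevel Q m * K := by
  have hK0 : 0 < K := (hQ 0).trans_le (hK 0)
  rw [← div_le_iff₀ hK0]
  refine le_csSup (bddAbove_lowerLevels hQc hQ) fun a b f f' h => ?_
  have hf := h.cont
  have h1 : ∫ x in a..b, Q x * f x ^ 2 ≤ K * ∫ x in a..b, f x ^ 2 := by
    rw [← intervalIntegral.integral_const_mul]
    exact intervalIntegral.integral_mono_on h.lt.le (h.intervalIntegrable (by fun_prop))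
      (h.intervalIntegrable (by fun_prop))
      fun x _ => mul_le_mul_of_nonneg_right (hK x) (sq_nonneg _)
  calc (m ^ 2 + 1 / 100) / K * ∫ x in a..b, Q x * f x ^ 2
      ≤ (m ^ 2 + 1 / 100) / K * (K * ∫ x in a..b, f x ^ 2) :=
        mul_le_mul_of_nonneg_left h1 (by positivity)
    _ = 1 / 100 * (∫ x in a..b, f x ^ 2) + m ^ 2 * ∫ x in a..b, f x ^ 2 := by field_simp; ring
    _ ≤ _ := by linarith [h.poincare]

/-- Comparison of weights up to a factor; it yields continuity of the eigenvalue without any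
perturbation theory of solutions. -/
theorem groundLevel_le_mul {Q₁ Q₂ : ℝ → ℝ} (hc₁ : Continuous Q₁) (h₁ : ∀ x, 0 < Q₁ x)
    (hc₂ : Continuous Q₂) (h₂ : ∀ x, 0 < Q₂ x) {c : ℝ} (hc : 0 < c)
    (h : ∀ x ∈ Icc (0 : ℝ) 4, Q₂ x ≤ c * Q₁ x) : groundLevel Q₁ m ≤ c * groundLevel Q₂ m := by
  rw [mul_comm, ← div_le_iff₀ hc]
  refine le_csSup (bddAbove_lowerLevels hc₂ h₂) fun a b f f' ht => ?_
  have hf := ht.cont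
  have h3 : ∫ x in a..b, Q₂ x * f x ^ 2 ≤ c * ∫ x in a..b, Q₁ x * f x ^ 2 := by
    rw [← intervalIntegral.integral_const_mul]
    refine intervalIntegral.integral_mono_on ht.lt.le (ht.intervalIntegrable (by fun_prop))
      (ht.intervalIntegrable (by fun_prop)) fun x hx => ?_
    rw [← mul_assoc]
    exact mul_le_mul_of_nonneg_right (h x (ht.subset hx)) (sq_nonneg _)
  calc groundLevel Q₁ m / c * ∫ x in a..b, Q₂ x * f x ^ 2
      ≤ groundLevel Q₁ m / c * (c * ∫ x in a..b, Q₁ x * f x ^ 2) :=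
        mul_le_mul_of_nonneg_left h3 (div_nonneg (groundLevel_nonneg hc₁ h₁) hc.le)
    _ = groundLevel Q₁ m * ∫ x in a..b, Q₁ x * f x ^ 2 := by field_simp
    _ ≤ _ := groundLevel_mem h₁ a b f f' ht

/-- A nontrivial solution of the Dirichlet problem on a subinterval is extremal. -/
theorem le_of_solution (hQc : Continuous Q) (hQ : ∀ x, 0 < Q x) {a b l l' : ℝ} {u v : ℝ → ℝ}
    (h : IsTest a b u v)
    (hv : ∀ x ∈ Icc a b, HasDerivWithinAt v (-((l * Q x - m ^ 2) * u x)) (Icc a b) x)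
    (hne : ∃ x ∈ Icc a b, u x ≠ 0) (hl' : l' ∈ lowerLevels Q m) : l' ≤ l := by
  have hu := h.cont
  obtain ⟨x₀, hx₀, hux₀⟩ := hne
  have hpos : 0 < ∫ x in a..b, Q x * u x ^ 2 := by
    refine intervalIntegral.integral_pos h.lt (by fun_prop)
      (fun x _ => mul_nonneg (hQ x).le (sq_nonneg _)) ⟨x₀, hx₀, ?_⟩
    have := hQ x₀
    positivity
  have h1 := h.integral_deriv_sq (by fun_prop) hv
  have h2 : ∀ x, (l * Q x - m ^ 2) * u x ^ 2 = l * (Q x * u x ^ 2) - m ^ 2 * u x ^ 2 :=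
    fun x => by ring
  simp only [h2] at h1
  rw [intervalIntegral.integral_sub (h.intervalIntegrable (by fun_prop))
    (h.intervalIntegrable (by fun_prop)), intervalIntegral.integral_const_mul,
    intervalIntegral.integral_const_mul] at h1
  have h3 := hl' a b u v h
  rw [h1, sub_add_cancel] at h3
  exact le_of_mul_le_mul_right h3 hpos

theorem exists_bound_potential (hQc : Continuous Q) (l m : ℝ) :
    ∃ K : NNReal, ∀ x ∈ Icc (0 : ℝ) 4, |l * Q x - m ^ 2| ≤ K := by
  obtain ⟨C, hC⟩ := (isCompact_Icc (a := (0 : ℝ)) (b := 4)).exists_bound_of_continuousOn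
    (f := fun x => l * Q x - m ^ 2) (by fun_prop)
  exact ⟨⟨|C|, abs_nonneg C⟩, fun x hx => (hC x hx).trans (le_abs_self C)⟩

theorem IsPruferAngle.exists_eq_half_pi {c θ : ℝ → ℝ} (h : IsPruferAngle c θ) (h0 : θ 0 = 0)
    {b : ℝ} (hb0 : 0 ≤ b) (hb4 : b ≤ 4) (hb : θ b = π) : ∃ x ∈ Icc 0 b, θ x = π / 2 := by
  have hsub : Icc (0 : ℝ) b ⊆ Icc 0 4 := Icc_subset_Icc_right hb4
  have := intermediate_value_Icc hb0 (h.continuousOn.mono hsub)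
  obtain ⟨x, hx, hx'⟩ := @this (π / 2)
    ⟨by rw [h0]; exact pi_div_two_pos.le, by rw [hb]; linarith [pi_pos]⟩
  exact ⟨x, hx, hx'⟩

/-- The angle equals `π` at some `b ≤ 4`, so `r sin θ` solves the Dirichlet problem on `[0, b]`.
Test functions on subintervals are admitted for this reason: an extension by zero would not be `C¹`.
-/
theorem groundLevel_le_of_pi_le (hQc : Continuous Q) (hQ : ∀ x, 0 < Q x) {l : ℝ} {θ : ℝ → ℝ}
    (h : IsPruferAngle (fun x => l * Q x - m ^ 2) θ) (h0 : θ 0 = 0) (h4 : π ≤ θ 4) :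
    groundLevel Q m ≤ l := by
  obtain ⟨b, hb, hθb⟩ := intermediate_value_Icc (by norm_num : (0 : ℝ) ≤ 4) h.continuousOn
    ⟨by rw [h0]; exact pi_pos.le, h4⟩
  have hb0 : 0 < b := hb.1.lt_of_ne fun h' => by
    rw [← h', h0] at hθb; exact pi_pos.ne hθb
  have hsub : Icc (0 : ℝ) b ⊆ Icc 0 4 := Icc_subset_Icc_right hb.2
  obtain ⟨r, hr, hd⟩ := h.exists_amplitude (by fun_prop)
  obtain ⟨x, hx, hθx⟩ := h.exists_eq_half_pi h0 hb.1 hb.2 hθb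
  refine le_of_solution hQc hQ (a := 0) (b := b) (u := fun x => r x * sin (θ x))
    (v := fun x => r x * cos (θ x)) ?_ (fun x hx => ((hd x (hsub hx)).2).mono hsub)
    ⟨x, hx, ?_⟩ (groundLevel_mem hQ)
  · exact ⟨le_rfl, hb0, hb.2, fun x hx => (hd x (hsub hx)).1.mono hsub,
      fun x hx => ((hd x (hsub hx)).2.mono hsub).continuousWithinAt, by simp [h0], by simp [hθb]⟩
  · simp [hθx, (hr x).ne']

/-- A slightly larger initial angle `δ` gives a Prüfer angle staying strictly between `0` and `π`;
its cotangent is a Riccati weight on all of `[0, 4]`, and the Riccati bound is the required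
inequality. -/
theorem mem_lowerLevels_of_lt_pi (hQc : Continuous Q) {l : ℝ} {θ : ℝ → ℝ}
    (h : IsPruferAngle (fun x => l * Q x - m ^ 2) θ) (h0 : θ 0 = 0) (h4 : θ 4 < π) :
    l ∈ lowerLevels Q m := by
  obtain ⟨K, hK⟩ := exists_bound_potential hQc l m
  set E := exp ((K + 1) * 4) with hE
  have hE0 : 0 < E := exp_pos _
  -- Grönwall magnifies the initial shift by at most `E`, which uses up half of the gap `π - θ 4`.
  set δ := (π - θ 4) / (2 * E) with hδ
  have hδ0 : 0 < δ := div_pos (by linarith) (by positivity)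
  obtain ⟨η, hη0, hη⟩ := exists_isPruferAngle (c := fun x => l * Q x - m ^ 2) (by fun_prop) hK δ
  have h4mem : (4 : ℝ) ∈ Icc (0 : ℝ) 4 := ⟨by norm_num, le_rfl⟩
  have hη4 : η 4 < π := by
    have := h.dist_le hη hK (ε := 0) (δ := δ) (by simp) (by rw [h0, hη0, zero_sub, abs_neg,
      abs_of_pos hδ0]) 4 h4mem
    rw [gronwallBound_ε0, ← hE, hδ] at this
    have h5 : (π - θ 4) / (2 * E) * E = (π - θ 4) / 2 := by field_simp
    rw [h5] at this
    have := (abs_le.1 this).1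
    linarith
  have hpos : ∀ x ∈ Icc (0 : ℝ) 4, 0 < η x := fun x hx => by
    have := hη.le_of_le K.2 hK (n := 0) (η := δ) hδ0.le le_rfl hx.1 hx.2 (by simp [hη0])
    refine lt_of_lt_of_le ?_ this
    simp only [CharP.cast_eq_zero, zero_mul, zero_add]
    positivity
  have hlt : ∀ x ∈ Icc (0 : ℝ) 4, η x < π := fun x hx => by
    by_contra hcon
    have := hη.le_of_le K.2 hK (n := 1) (η := 0) le_rfl hx.1 hx.2 le_rfl
      (by simpa using not_lt.1 hcon)
    simp only [Nat.cast_one, one_mul, zero_mul, add_zero] at this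
    linarith
  have hsin : ∀ x ∈ Icc (0 : ℝ) 4, sin (η x) ≠ 0 := fun x hx =>
    (sin_pos_of_pos_of_lt_pi (hpos x hx) (hlt x hx)).ne'
  intro a b f f' ht
  have hf := ht.cont
  have hηc := hη.continuousOn.mono ht.subset
  have hcot : ContinuousOn (fun x => cos (η x) / sin (η x)) (Icc a b) :=
    ContinuousOn.div (by fun_prop) (by fun_prop) fun x hx => hsin x (ht.subset hx)
  have := ht.riccati (w := fun x => cos (η x) / sin (η x))
    (w' := fun x => -(cos (η x) / sin (η x)) ^ 2 - (l * Q x - m ^ 2))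
    (fun x hx => (hη.hasDerivWithinAt_cot (ht.subset hx) (hsin x (ht.subset hx))).mono ht.subset)
    ((hcot.pow 2).neg.sub (by fun_prop))
  have h2 : ∀ x, -(-(cos (η x) / sin (η x)) ^ 2 - (l * Q x - m ^ 2) +
      (cos (η x) / sin (η x)) ^ 2) * f x ^ 2 = l * (Q x * f x ^ 2) - m ^ 2 * f x ^ 2 :=
    fun x => by ring
  simp only [h2] at this
  rw [intervalIntegral.integral_sub (ht.intervalIntegrable (by fun_prop))
    (ht.intervalIntegrable (by fun_prop)), intervalIntegral.integral_const_mul,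
    intervalIntegral.integral_const_mul] at this
  linarith

/-- Below the ground level the final angle is at most `π`, or else the level would be smaller; above
it the angle is at least `π`, or else the level would be larger. Since the final angle depends
continuously on `l`, by Grönwall, equality holds at the level itself. -/
theorem prufer_groundLevel (hQc : Continuous Q) (hQ : ∀ x, 0 < Q x) {θ : ℝ → ℝ}
    (h : IsPruferAngle (fun x => groundLevel Q m * Q x - m ^ 2) θ) (h0 : θ 0 = 0) : θ 4 = π := by
  obtain ⟨K, hK⟩ := exists_bound_potential hQc (groundLevel Q m) m
  obtain ⟨B, hB⟩ := (isCompact_Icc (a := (0 : ℝ)) (b := 4)).exists_bound_of_continuousOn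
    hQc.continuousOn
  have hB0 : 0 ≤ B := (norm_nonneg _).trans (hB 0 ⟨le_rfl, by norm_num⟩)
  set C := B / (K + 1) * (exp ((K + 1) * 4) - 1) with hC
  have hC0 : 0 ≤ C := mul_nonneg (by positivity)
    (sub_nonneg.2 (one_le_exp (by positivity)))
  have hK1 : (K : ℝ) + 1 ≠ 0 := by positivity
  have close : ∀ (s l : ℝ) (η : ℝ → ℝ), |l - groundLevel Q m| ≤ s →
      IsPruferAngle (fun x => l * Q x - m ^ 2) η → η 0 = 0 → |θ 4 - η 4| ≤ s * C := by
    intro s l η hs hη hη0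
    have := h.dist_le hη hK (ε := s * B) (δ := 0) (fun x hx => ?_) (by simp [h0, hη0]) 4
      ⟨by norm_num, le_rfl⟩
    · rw [gronwallBound_of_K_ne_0 hK1] at this
      beta_reduce at this
      rw [zero_mul, zero_add] at this
      refine this.trans_eq ?_
      rw [hC]; ring
    · have e : l * Q x - m ^ 2 - (groundLevel Q m * Q x - m ^ 2) = (l - groundLevel Q m) * Q x := by
        ring
      rw [e, abs_mul]
      exact mul_le_mul hs (hB x hx) (abs_nonneg _) ((abs_nonneg _).trans hs)
  have sol : ∀ l, ∃ η, η 0 = 0 ∧ IsPruferAngle (fun x => l * Q x - m ^ 2) η := fun l => by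
    obtain ⟨K', hK'⟩ := exists_bound_potential hQc l m
    exact exists_isPruferAngle (by fun_prop) hK' 0
  have upper : ∀ s > 0, θ 4 ≤ π + s * C := fun s hs => by
    obtain ⟨η, hη0, hη⟩ := sol (groundLevel Q m - s)
    have h1 := close s _ η (by rw [sub_sub_cancel_left, abs_neg, abs_of_pos hs]) hη hη0
    have h2 : η 4 < π := by
      by_contra hcon
      linarith [groundLevel_le_of_pi_le hQc hQ hη hη0 (not_lt.1 hcon)]
    linarith [(abs_le.1 h1).2]
  have lower : ∀ s > 0, π ≤ θ 4 + s * C := fun s hs => by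
    obtain ⟨η, hη0, hη⟩ := sol (groundLevel Q m + s)
    have h1 := close s _ η (by rw [add_sub_cancel_left, abs_of_pos hs]) hη hη0
    have h2 : π ≤ η 4 := by
      by_contra hcon
      have : groundLevel Q m + s ≤ groundLevel Q m :=
        le_csSup (bddAbove_lowerLevels hQc hQ) (mem_lowerLevels_of_lt_pi hQc hη hη0 (not_le.1 hcon))
      linarith
    linarith [(abs_le.1 h1).1]
  have lim : ∀ e > 0, ∃ s > 0, s * C ≤ e := fun e he =>
    ⟨e / (C + 1), by positivity, by
      rw [div_mul_eq_mul_div, div_le_iff₀ (by positivity)]; nlinarith⟩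
  refine le_antisymm (le_of_forall_pos_le_add fun e he => ?_)
    (le_of_forall_pos_le_add fun e he => ?_)
  · obtain ⟨s, hs, hsC⟩ := lim e he
    linarith [upper s hs]
  · obtain ⟨s, hs, hsC⟩ := lim e he
    linarith [lower s hs]

/-- The first Dirichlet eigenvalue exists and is given by the variational principle. -/
theorem isFirstDirichletEigenvalue_groundLevel (hQc : Continuous Q) (hQ : ∀ x, 0 < Q x) :
    IsFirstDirichletEigenvalue Q m (groundLevel Q m) := by
  constructor
  · obtain ⟨K, hK⟩ := exists_bound_potential hQc (groundLevel Q m) m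
    obtain ⟨θ, h0, hθ⟩ := exists_isPruferAngle
      (c := fun x => groundLevel Q m * Q x - m ^ 2) (by fun_prop) hK 0
    have h4 := prufer_groundLevel hQc hQ hθ h0
    obtain ⟨r, hr, hd⟩ := hθ.exists_amplitude (by fun_prop)
    obtain ⟨x, hx, hθx⟩ := hθ.exists_eq_half_pi h0 (by norm_num) le_rfl h4
    exact ⟨fun x => r x * sin (θ x), fun x => r x * cos (θ x),
      ⟨x, hx, by simp [hθx, (hr x).ne']⟩, by simp [h0], by simp [h4], hd⟩
  · rintro l ⟨u, v, hne, hu0, hu4, huv⟩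
    exact le_of_solution hQc hQ (a := 0) (b := 4)
      ⟨le_rfl, by norm_num, le_rfl, fun x hx => (huv x hx).1,
        fun x hx => (huv x hx).2.continuousWithinAt, hu0, hu4⟩ (fun x hx => (huv x hx).2) hne
      (groundLevel_mem hQ)

/-- On a compact parameter set the weights are bounded below and uniformly continuous, so nearby
weights have ratios at most `1 + s` in both directions, and so do their ground levels. -/
theorem continuousOn_groundLevel {X : Type*} [PseudoMetricSpace X] {K : Set X} (hK : IsCompact K)
    {P : X → ℝ → ℝ} (hP : ContinuousOn (Function.uncurry P) (K ×ˢ Icc 0 4))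
    (hc : ∀ t ∈ K, Continuous (P t)) (hpos : ∀ t ∈ K, ∀ x, 0 < P t x) :
    ContinuousOn (fun t => groundLevel (P t) m) K := by
  intro t₀ ht₀
  have hcomp : IsCompact (K ×ˢ Icc (0 : ℝ) 4) := hK.prod isCompact_Icc
  have h0 : (0 : ℝ) ∈ Icc (0 : ℝ) 4 := ⟨le_rfl, by norm_num⟩
  obtain ⟨p, hp, hmin⟩ := hcomp.exists_isMinOn ⟨(t₀, 0), ht₀, h0⟩ hP
  have hc0 := hpos p.1 hp.1 p.2
  have hlow : ∀ t ∈ K, ∀ x ∈ Icc (0 : ℝ) 4, P p.1 p.2 ≤ P t x := fun t ht x hx =>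
    hmin (Set.mk_mem_prod ht hx)
  have hG0 := groundLevel_nonneg (m := m) (hc t₀ ht₀) (hpos t₀ ht₀)
  rw [Metric.continuousWithinAt_iff]
  intro e he
  obtain ⟨s, hs0, hs1, hs⟩ : ∃ s : ℝ, 0 < s ∧ s ≤ 1 ∧ 2 * s * groundLevel (P t₀) m < e := by
    refine ⟨min 1 (e / (2 * groundLevel (P t₀) m + 1)), lt_min one_pos (by positivity),
      min_le_left _ _, ?_⟩
    have h1 : min 1 (e / (2 * groundLevel (P t₀) m + 1)) * (2 * groundLevel (P t₀) m + 1) ≤ e := by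
      rw [← le_div_iff₀ (by positivity)]; exact min_le_right _ _
    have h2 : 0 < min 1 (e / (2 * groundLevel (P t₀) m + 1)) := lt_min one_pos (by positivity)
    linarith
  obtain ⟨δ, hδ, hu⟩ := Metric.uniformContinuousOn_iff.1
    (hcomp.uniformContinuousOn_of_continuous hP) (s * P p.1 p.2) (by positivity)
  refine ⟨δ, hδ, fun {t} ht htd => ?_⟩
  have hclose : ∀ x ∈ Icc (0 : ℝ) 4, |P t x - P t₀ x| ≤ s * P p.1 p.2 := fun x hx => by
    have := hu (t, x) ⟨ht, hx⟩ (t₀, x) ⟨ht₀, hx⟩ (by simpa [Prod.dist_eq] using htd)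
    exact this.le
  have h1 := groundLevel_le_mul (m := m) (c := 1 + s) (hc t₀ ht₀) (hpos t₀ ht₀) (hc t ht)
    (hpos t ht) (by linarith) fun x hx => by
      have h1 := (abs_le.1 (hclose x hx)).2
      have h2 := mul_le_mul_of_nonneg_left (hlow t₀ ht₀ x hx) hs0.le
      linarith
  have h2 := groundLevel_le_mul (m := m) (c := 1 + s) (hc t ht) (hpos t ht) (hc t₀ ht₀)
    (hpos t₀ ht₀) (by linarith) fun x hx => by
      have h1 := (abs_le.1 (hclose x hx)).1
      have h2 := mul_le_mul_of_nonneg_left (hlow t ht x hx) hs0.le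
      linarith
  rw [Real.dist_eq, abs_lt]
  have h3 : s * groundLevel (P t) m ≤ s * ((1 + s) * groundLevel (P t₀) m) :=
    mul_le_mul_of_nonneg_left h2 hs0.le
  have h4 : s * ((1 + s) * groundLevel (P t₀) m) ≤ s * (2 * groundLevel (P t₀) m) :=
    mul_le_mul_of_nonneg_left (mul_le_mul_of_nonneg_right (by linarith) hG0) hs0.le
  have h5 : 0 ≤ s * groundLevel (P t₀) m := mul_nonneg hs0.le hG0
  constructor <;> linarith

end Eigenvalue

/-! ### The cascade as a sum over disjoint annuli -/

noncomputable section Cascade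

/-- Smooth even functions vanishing outside `1/4 < |y| < 1`. -/
structure IsAnnular (g : ℝ → ℝ) : Prop where
  smooth : ContDiff ℝ ∞ g
  even : ∀ x, g (-x) = g x
  ne_zero : ∀ x, g x ≠ 0 → 1 / 4 < |x| ∧ |x| < 1

theorem IsCutoff.isAnnular {ψ : ℝ → ℝ} (h : IsCutoff ψ) : IsAnnular ψ := by
  refine ⟨h.smooth, h.even, fun x hx => ?_⟩
  rcases h.supp (subset_tsupport _ (Function.mem_support.2 hx)) with hx | hx
  · rw [abs_of_neg (by linarith [hx.2])]; constructor <;> linarith [hx.1, hx.2]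
  · rw [abs_of_pos (by linarith [hx.1])]; exact hx

theorem IsOscillating.abs_mem {h : ℝ → ℝ} {xinf : ℝ} (hh : IsOscillating h xinf) {x : ℝ}
    (hx : h x ≠ 0) : 1 / 2 < |x| ∧ |x| < 3 / 4 := by
  rcases hh.supp (subset_tsupport _ (Function.mem_support.2 hx)) with hx | hx
  · rw [abs_of_neg (by linarith [hx.2])]; constructor <;> linarith [hx.1, hx.2]
  · rw [abs_of_pos (by linarith [hx.1])]; exact hx

theorem IsOscillating.isAnnular {h : ℝ → ℝ} {xinf : ℝ} (hh : IsOscillating h xinf) :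
    IsAnnular h :=
  ⟨hh.smooth, hh.even, fun x hx => by
    have := hh.abs_mem hx
    constructor <;> linarith [this.1, this.2]⟩

theorem IsOscillating.exists_bound {h : ℝ → ℝ} {xinf : ℝ} (hh : IsOscillating h xinf) :
    ∃ B, 0 < B ∧ ∀ x, |h x| ≤ B := by
  obtain ⟨C, hC⟩ := (isCompact_Icc (a := (-1 : ℝ)) (b := 1)).exists_bound_of_continuousOn
    hh.smooth.continuous.continuousOn
  refine ⟨|C| + 1, by positivity, fun x => ?_⟩
  by_cases hx : h x = 0
  · rw [hx, abs_zero]; positivity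
  · have := hC x (abs_le.1 (by linarith [(hh.abs_mem hx).2]))
    rw [Real.norm_eq_abs] at this
    linarith [le_abs_self C]

/-- Midpoints of consecutive sign intervals converge to `xinf`; along one parity `h` is positive,
along the other negative. -/
theorem IsOscillating.apply_eq_zero {h : ℝ → ℝ} {xinf : ℝ} (hh : IsOscillating h xinf) :
    h xinf = 0 := by
  obtain ⟨x, hx, _, hlim, hsign, _⟩ := hh.oscillates
  set y : ℕ → ℝ := fun i => (x (i + 1) + x i) / 2 with hy
  have hymem : ∀ i, y i ∈ Ioo (x (i + 1)) (x i) := fun i => by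
    have := hx (Nat.lt_succ_self i)
    constructor <;> simp only [hy] <;> simp only [Nat.succ_eq_add_one] at this <;> linarith
  have hylim : Tendsto y atTop (𝓝 xinf) := by
    have := ((hlim.comp (tendsto_add_atTop_nat 1)).add hlim).div_const 2
    simpa using this
  have hhy : Tendsto (fun i => h (y i)) atTop (𝓝 (h xinf)) :=
    (hh.smooth.continuous.tendsto xinf).comp hylim
  have h2 : Tendsto (fun i : ℕ => 2 * i) atTop atTop :=
    tendsto_id.const_mul_atTop' two_pos
  have h3 : Tendsto (fun i : ℕ => 2 * i + 1) atTop atTop := (tendsto_add_atTop_nat 1).comp h2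
  refine le_antisymm (le_of_tendsto' (hhy.comp h3) fun i => ?_)
    (ge_of_tendsto' (hhy.comp h2) fun i => ?_)
  · have := hsign (2 * i + 1) _ (hymem _)
    rw [show 2 * i + 1 + 1 = 2 * (i + 1) by ring, pow_mul] at this
    simp only [even_two, Even.neg_pow, one_pow, one_mul] at this
    exact this.le
  · have := hsign (2 * i) _ (hymem _)
    rw [pow_succ, pow_mul] at this
    simp only [even_two, Even.neg_pow, one_pow, one_mul, neg_mul, Left.neg_neg_iff] at this
    exact this.le

theorem four_rpow_pos (t : ℝ) : 0 < (4 : ℝ) ^ t := Real.rpow_pos_of_pos (by norm_num) t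

theorem one_le_four_rpow {t : ℝ} (ht : 0 ≤ t) : 1 ≤ (4 : ℝ) ^ t :=
  Real.one_le_rpow (by norm_num) ht

theorem four_rpow_neg_mem {t : ℝ} (ht : 0 ≤ t) : (4 : ℝ) ^ (-t) ∈ Icc (0 : ℝ) 1 :=
  ⟨(four_rpow_pos _).le, Real.rpow_le_one_of_one_le_of_nonpos (by norm_num) (by linarith)⟩

theorem four_rpow_le {s t : ℝ} (h : s ≤ t) : (4 : ℝ) ^ s ≤ (4 : ℝ) ^ t :=
  Real.rpow_le_rpow_of_exponent_le (by norm_num) h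

theorem four_rpow_mul_neg (t : ℝ) : (4 : ℝ) ^ t * (4 : ℝ) ^ (-t) = 1 := by
  rw [← Real.rpow_add (by norm_num)]; simp

theorem four_rpow_neg_add_one (t : ℝ) : (4 : ℝ) ^ (-(t + 1)) = (4 : ℝ) ^ (-t) / 4 := by
  rw [neg_add, Real.rpow_add (by norm_num), Real.rpow_neg_one]; ring

theorem four_mul_rpow_le {s t : ℝ} (h : s + 1 ≤ t) : 4 * (4 : ℝ) ^ s ≤ (4 : ℝ) ^ t := by
  refine le_trans (le_of_eq ?_) (four_rpow_le h)
  rw [Real.rpow_add (by norm_num), Real.rpow_one]; ring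

theorem cutPhi_eq (ψ : ℝ → ℝ) (t x : ℝ) : cutPhi ψ t x = 1 - cascadeH ψ t x := rfl

theorem cascadeH_add_two (g : ℝ → ℝ) (t x : ℝ) : cascadeH g t (x + 2) = cascadeH g t x := by
  unfold cascadeH
  rw [← (Equiv.addRight (1 : ℤ)).tsum_eq (fun n : ℤ => g ((4 : ℝ) ^ t * (x + 2 * n)))]
  refine tsum_congr fun n => ?_
  simp only [Equiv.coe_addRight]
  push_cast
  ring_nf

namespace IsAnnular

variable {g : ℝ → ℝ}

theorem cascadeH_neg (hg : IsAnnular g) (t x : ℝ) : cascadeH g t (-x) = cascadeH g t x := by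
  unfold cascadeH
  rw [← (Equiv.neg ℤ).tsum_eq (fun n : ℤ => g ((4 : ℝ) ^ t * (x + 2 * n)))]
  refine tsum_congr fun n => ?_
  rw [← hg.even]
  simp only [Equiv.neg_apply]
  push_cast
  ring_nf

theorem eq_zero_of_one_le (hg : IsAnnular g) {t y : ℝ} (ht : 0 ≤ t) (hy : 1 ≤ |y|) :
    g ((4 : ℝ) ^ t * y) = 0 := by
  by_contra h
  have := (hg.ne_zero _ h).2
  rw [abs_mul, abs_of_pos (four_rpow_pos t)] at this
  nlinarith [one_le_four_rpow ht]

theorem cascadeH_eq_sum (hg : IsAnnular g) {t x : ℝ} (ht : 0 ≤ t) {R : ℕ} (hx : |x| ≤ R) :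
    cascadeH g t x = ∑ n ∈ Finset.Icc (-(R : ℤ)) R, g ((4 : ℝ) ^ t * (x + 2 * n)) := by
  refine tsum_eq_sum fun n hn => hg.eq_zero_of_one_le ht ?_
  have hx := abs_le.1 hx
  rw [Finset.mem_Icc, not_and_or, not_le, not_le] at hn
  rcases hn with hn | hn
  · have h1 : (n : ℝ) + 1 ≤ -R := by exact_mod_cast hn
    rw [le_abs]; right; linarith [hx.2, (Nat.cast_nonneg R : (0 : ℝ) ≤ R)]
  · have h1 : (R : ℝ) + 1 ≤ n := by exact_mod_cast hn
    rw [le_abs]; left; linarith [hx.1, (Nat.cast_nonneg R : (0 : ℝ) ≤ R)]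

theorem cascadeH_eq (hg : IsAnnular g) {t x : ℝ} (ht : 0 ≤ t) (hx : |x| ≤ 1) :
    cascadeH g t x = g ((4 : ℝ) ^ t * x) := by
  unfold cascadeH
  rw [tsum_eq_single 0]
  · simp
  · intro n hn
    refine hg.eq_zero_of_one_le ht ?_
    have hx := abs_le.1 hx
    rcases lt_or_gt_of_ne hn with hn | hn
    · have h1 : (n : ℝ) + 1 ≤ 0 := by exact_mod_cast hn
      rw [le_abs]; right; linarith [hx.2]
    · have h1 : (0 : ℝ) + 1 ≤ n := by exact_mod_cast hn
      rw [le_abs]; left; linarith [hx.1]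

theorem contDiff_cascadeH (hg : IsAnnular g) {t : ℝ} (ht : 0 ≤ t) :
    ContDiff ℝ ∞ (cascadeH g t) := by
  rw [contDiff_iff_contDiffAt]
  intro x
  obtain ⟨R, hR⟩ := exists_nat_gt |x|
  have hs := hg.smooth
  have h1 : ContDiff ℝ ∞ fun x : ℝ =>
      ∑ n ∈ Finset.Icc (-(R : ℤ)) R, g ((4 : ℝ) ^ t * (x + 2 * n)) :=
    ContDiff.sum fun n _ => hs.comp (by fun_prop)
  refine h1.contDiffAt.congr_of_eventuallyEq ?_
  filter_upwards [continuous_abs.continuousAt.eventually_lt continuousAt_const hR] with y hy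
  exact hg.cascadeH_eq_sum ht hy.le

theorem continuousOn_cascadeH (hg : IsAnnular g) :
    ContinuousOn (fun p : ℝ × ℝ => cascadeH g p.1 p.2) (Ici 0 ×ˢ Icc 0 4) := by
  have hs := hg.smooth.continuous
  have h4 : Continuous fun t : ℝ => (4 : ℝ) ^ t := Real.continuous_const_rpow (by norm_num)
  have h1 : Continuous fun p : ℝ × ℝ =>
      ∑ n ∈ Finset.Icc (-((4 : ℕ) : ℤ)) (4 : ℕ), g ((4 : ℝ) ^ p.1 * (p.2 + 2 * n)) := by
    refine continuous_finsetSum _ fun n _ => hs.comp ?_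
    exact (h4.comp continuous_fst).mul (by fun_prop)
  refine h1.continuousOn.congr fun p hp => hg.cascadeH_eq_sum hp.1 ?_
  rw [abs_of_nonneg hp.2.1]
  exact hp.2.2

end IsAnnular

/-- Even `2`-periodic functions are determined by their values on `[0, 1]`. -/
theorem exists_mem_Icc_zero_one (x : ℝ) : ∃ y ∈ Icc (0 : ℝ) 1, ∀ F : ℝ → ℝ,
    (∀ z, F (-z) = F z) → (∀ z, F (z + 2) = F z) → F x = F y := by
  obtain ⟨n, hn, -⟩ := existsUnique_add_zsmul_mem_Ico (two_pos : (0 : ℝ) < 2) x (-1)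
  refine ⟨|x + n • (2 : ℝ)|, ⟨abs_nonneg _, abs_le.2 ⟨hn.1, by linarith [hn.2]⟩⟩, fun F he hp => ?_⟩
  have h1 : F (x + n • (2 : ℝ)) = F x := (show Function.Periodic F 2 from hp).zsmul n x
  rw [← h1]
  rcases abs_choice (x + n • (2 : ℝ)) with h | h <;> rw [h]
  rw [he]

variable {ι : Type*}

/-- The contribution of one scale to the cascade. -/
def cascadeTerm (ψ q h : ℝ → ℝ) (t τ x : ℝ) : ℝ :=
  -(cascadeH ψ t x * (q x - q ((4 : ℝ) ^ (-t)))) + τ * cascadeH h t x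

/-- The explicit sum formula for the cascade. -/
def cascadeSum [Fintype ι] (ψ q h : ℝ → ℝ) (t τ : ι → ℝ) (x : ℝ) : ℝ :=
  q x + ∑ i, cascadeTerm ψ q h (t i) (τ i) x

/-- On `[0, 1]` scale `t` acts only where `4^{-t} / 4 < x < 4^{-t}`. The radii have ratio `4`, so
scales at distance at least `1` have disjoint annuli. -/
theorem IsAnnular.mul_cascadeH_eq_zero {g₁ g₂ : ℝ → ℝ} (h₁ : IsAnnular g₁) (h₂ : IsAnnular g₂)
    {s t : ℝ} (hs : 0 ≤ s) (ht : 0 ≤ t) (hst : 1 ≤ |s - t|) (x : ℝ) :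
    cascadeH g₁ s x * cascadeH g₂ t x = 0 := by
  obtain ⟨y, hy, hxy⟩ := exists_mem_Icc_zero_one x
  have hy1 : |y| ≤ 1 := by rw [abs_of_nonneg hy.1]; exact hy.2
  rw [hxy (cascadeH g₁ s) (h₁.cascadeH_neg s) (cascadeH_add_two g₁ s),
    hxy (cascadeH g₂ t) (h₂.cascadeH_neg t) (cascadeH_add_two g₂ t), h₁.cascadeH_eq hs hy1,
    h₂.cascadeH_eq ht hy1]
  by_contra hne
  have a1 := h₁.ne_zero _ (left_ne_zero_of_mul hne)
  have a2 := h₂.ne_zero _ (right_ne_zero_of_mul hne)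
  rw [abs_of_nonneg (mul_nonneg (four_rpow_pos _).le hy.1)] at a1 a2
  rcases le_abs.1 hst with h | h
  · have := mul_le_mul_of_nonneg_right (four_mul_rpow_le (by linarith : t + 1 ≤ s)) hy.1
    linarith [a1.2, a2.1]
  · have := mul_le_mul_of_nonneg_right (four_mul_rpow_le (by linarith : s + 1 ≤ t)) hy.1
    linarith [a1.1, a2.2]

/-- The outer radius of an open annulus lies neither in it nor in the annuli of separated scales.
Hence the plateau value at scale `t` is `q(4^{-t})`, whatever scales were treated before. -/
theorem IsAnnular.cascadeH_rpow_neg {g : ℝ → ℝ} (hg : IsAnnular g) {s t : ℝ} (hs : 0 ≤ s)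
    (ht : 0 ≤ t) (hst : s = t ∨ 1 ≤ |s - t|) : cascadeH g s ((4 : ℝ) ^ (-t)) = 0 := by
  have hm := four_rpow_neg_mem ht
  rw [hg.cascadeH_eq hs (by rw [abs_of_nonneg hm.1]; exact hm.2), ← Real.rpow_add (by norm_num)]
  by_contra hne
  have := hg.ne_zero _ hne
  rw [abs_of_pos (four_rpow_pos _)] at this
  rcases hst with h | h
  · rw [h] at this; simp at this
  · rcases le_abs.1 h with h | h
    · linarith [one_le_four_rpow (by linarith : 0 ≤ s + -t)]
    · have := four_mul_rpow_le (by linarith : s + -t + 1 ≤ 0)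
      rw [Real.rpow_zero] at this
      linarith

theorem cascadeTerm_eq_zero {ψ q h : ℝ → ℝ} {t x : ℝ} (τ : ℝ) (h1 : cascadeH ψ t x = 0)
    (h2 : cascadeH h t x = 0) : cascadeTerm ψ q h t τ x = 0 := by
  simp [cascadeTerm, h1, h2]

variable {ψ q h : ℝ → ℝ}

theorem cascade_eq (hψ : IsAnnular ψ) (hh : IsAnnular h) (T : ℝ → ℝ) (S : Finset ℝ)
    (h0 : ∀ s ∈ S, 0 ≤ s) (hsep : ∀ s ∈ S, ∀ t ∈ S, s ≠ t → 1 ≤ |s - t|) (x : ℝ) :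
    cascade ψ q h S (fun s => T s) x = q x + ∑ s ∈ S, cascadeTerm ψ q h s (T s) x := by
  classical
  induction hn : S.card generalizing S x with
  | zero =>
    rw [Finset.card_eq_zero] at hn
    subst hn
    rw [cascade]
    simp
  | succ n ih =>
    have hS : ∃ a, a ∈ S := Finset.card_pos.1 (by omega)
    rw [cascade, dif_pos hS]
    have htS := hS.choose_spec
    set t := hS.choose with ht
    have ih' : ∀ y, cascade ψ q h (S.erase t) (fun s => T s) y
        = q y + ∑ s ∈ S.erase t, cascadeTerm ψ q h s (T s) y := fun y =>
      ih (S.erase t) (fun s hs => h0 s (Finset.mem_of_mem_erase hs))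
        (fun s hs r hr => hsep s (Finset.mem_of_mem_erase hs) r (Finset.mem_of_mem_erase hr)) y
        (by rw [Finset.card_erase_of_mem htS, hn]; rfl)
    have hgt : cascade ψ q h (S.erase t) (fun s => T s) ((4 : ℝ) ^ (-t)) = q ((4 : ℝ) ^ (-t)) := by
      rw [ih', Finset.sum_eq_zero, add_zero]
      intro s hs
      have hs' := Finset.mem_of_mem_erase hs
      have hst := hsep s hs' t htS (Finset.ne_of_mem_erase hs)
      exact cascadeTerm_eq_zero _ (hψ.cascadeH_rpow_neg (h0 s hs') (h0 t htS) (Or.inr hst))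
        (hh.cascadeH_rpow_neg (h0 s hs') (h0 t htS) (Or.inr hst))
    -- Multiplication by `φ_t` therefore leaves the terms of the other scales unchanged, and the
    -- recursion becomes additive.
    have hprod : cascadeH ψ t x * ∑ s ∈ S.erase t, cascadeTerm ψ q h s (T s) x = 0 := by
      rw [Finset.mul_sum]
      refine Finset.sum_eq_zero fun s hs => ?_
      have hs' := Finset.mem_of_mem_erase hs
      have hst := hsep t htS s hs' (Finset.ne_of_mem_erase hs).symm
      have e1 := hψ.mul_cascadeH_eq_zero hψ (h0 t htS) (h0 s hs') hst x
      have e2 := hψ.mul_cascadeH_eq_zero hh (h0 t htS) (h0 s hs') hst x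
      rw [cascadeTerm]
      linear_combination -(q x - q ((4 : ℝ) ^ (-s))) * e1 + T s * e2
    rw [← Finset.add_sum_erase S _ htS]
    dsimp only
    rw [hgt, ih', cutPhi_eq, cascadeTerm]
    linear_combination -hprod

/-- Admissible scales: nonnegative and `1`-separated. -/
structure IsSeparated (t : ι → ℝ) : Prop where
  nonneg : ∀ i, 0 ≤ t i
  sep : ∀ i j, i ≠ j → 1 ≤ |t i - t j|

theorem IsSeparated.injective {t : ι → ℝ} (ht : IsSeparated t) : Function.Injective t := by
  intro i j hij
  by_contra hne
  have := ht.sep i j hne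
  rw [hij, sub_self, abs_zero] at this
  linarith

variable [Fintype ι] {t τ : ι → ℝ}

theorem cascade_image_eq (hψ : IsAnnular ψ) (hh : IsAnnular h) (ht : IsSeparated t)
    {T : ℝ → ℝ} (hT : ∀ i, T (t i) = τ i) [DecidableEq ℝ] :
    cascade ψ q h (Finset.univ.image t) (fun s => T s) = cascadeSum ψ q h t τ := by
  ext x
  rw [cascade_eq hψ hh, cascadeSum, Finset.sum_image fun i _ j _ hij => ht.injective hij]
  · simp only [hT]
  · intro s hs
    obtain ⟨i, -, rfl⟩ := Finset.mem_image.1 hs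
    exact ht.nonneg i
  · intro s hs r hr hne
    obtain ⟨i, -, rfl⟩ := Finset.mem_image.1 hs
    obtain ⟨j, -, rfl⟩ := Finset.mem_image.1 hr
    exact ht.sep i j fun hij => hne (by rw [hij])

theorem cascadeSum_even (hψ : IsAnnular ψ) (hh : IsAnnular h) (hq : ∀ x, q (-x) = q x) (x : ℝ) :
    cascadeSum ψ q h t τ (-x) = cascadeSum ψ q h t τ x := by
  simp only [cascadeSum, cascadeTerm, hq, hψ.cascadeH_neg, hh.cascadeH_neg]

theorem cascadeSum_periodic (hq : ∀ x, q (x + 2) = q x) (x : ℝ) :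
    cascadeSum ψ q h t τ (x + 2) = cascadeSum ψ q h t τ x := by
  simp only [cascadeSum, cascadeTerm, hq, cascadeH_add_two]

theorem contDiff_cascadeSum (hψ : IsAnnular ψ) (hh : IsAnnular h) (hq : ContDiff ℝ ∞ q)
    (ht : ∀ i, 0 ≤ t i) : ContDiff ℝ ∞ (cascadeSum ψ q h t τ) := by
  have h1 : ∀ i, ContDiff ℝ ∞ (cascadeTerm ψ q h (t i) (τ i)) := fun i => by
    have a := hψ.contDiff_cascadeH (ht i)
    have b := hh.contDiff_cascadeH (ht i)
    unfold cascadeTerm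
    fun_prop
  unfold cascadeSum
  exact hq.add (ContDiff.sum fun i _ => h1 i)

theorem continuousOn_cascadeSum (hψ : IsAnnular ψ) (hh : IsAnnular h) (hq : Continuous q)
    {K : Set (ι → ℝ)} (hK : ∀ t ∈ K, ∀ i, 0 ≤ t i) :
    ContinuousOn (Function.uncurry fun t : ι → ℝ => cascadeSum ψ q h t τ) (K ×ˢ Icc 0 4) := by
  have hmap : ∀ i, MapsTo (fun p : (ι → ℝ) × ℝ => (p.1 i, p.2)) (K ×ˢ Icc 0 4)
      (Ici 0 ×ˢ Icc (0 : ℝ) 4) := fun i p hp => ⟨hK p.1 hp.1 i, hp.2⟩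
  have h4 : Continuous fun t : ℝ => (4 : ℝ) ^ (-t) :=
    (Real.continuous_const_rpow (by norm_num)).comp continuous_neg
  refine ContinuousOn.add (by fun_prop) (continuousOn_finsetSum _ fun i _ => ?_)
  have a : ContinuousOn (fun p : (ι → ℝ) × ℝ => cascadeH ψ (p.1 i) p.2) (K ×ˢ Icc 0 4) :=
    hψ.continuousOn_cascadeH.comp (f := fun p : (ι → ℝ) × ℝ => (p.1 i, p.2)) (by fun_prop) (hmap i)
  have b : ContinuousOn (fun p : (ι → ℝ) × ℝ => cascadeH h (p.1 i) p.2) (K ×ˢ Icc 0 4) :=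
    hh.continuousOn_cascadeH.comp (f := fun p : (ι → ℝ) × ℝ => (p.1 i, p.2)) (by fun_prop) (hmap i)
  have c : Continuous fun p : (ι → ℝ) × ℝ => q p.2 - q ((4 : ℝ) ^ (-(p.1 i))) :=
    (hq.comp continuous_snd).sub (hq.comp (h4.comp (by fun_prop)))
  exact (a.mul c.continuousOn).neg.add (continuousOn_const.mul b)

/-- On the annulus of one scale only that scale contributes. -/
theorem cascadeSum_eq_of_mem_annulus (hψ : IsAnnular ψ) (hh : IsAnnular h) (ht : IsSeparated t)
    {i : ι} {x : ℝ} (hx : |x| ≤ 1) (hi : cascadeH ψ (t i) x ≠ 0) :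
    cascadeSum ψ q h t τ x
      = q x - ψ ((4 : ℝ) ^ t i * x) * (q x - q ((4 : ℝ) ^ (-(t i))))
        + τ i * h ((4 : ℝ) ^ t i * x) := by
  rw [cascadeSum, Finset.sum_eq_single_of_mem i (Finset.mem_univ i), cascadeTerm,
    hψ.cascadeH_eq (ht.nonneg i) hx, hh.cascadeH_eq (ht.nonneg i) hx]
  · ring
  · intro j _ hji
    have hs := ht.sep i j hji.symm
    exact cascadeTerm_eq_zero _
      ((mul_eq_zero.1 (hψ.mul_cascadeH_eq_zero hψ (ht.nonneg i) (ht.nonneg j) hs x)).resolve_left hi)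
      ((mul_eq_zero.1 (hψ.mul_cascadeH_eq_zero hh (ht.nonneg i) (ht.nonneg j) hs x)).resolve_left hi)

theorem IsCutoff.eq_one_of_oscillating_ne_zero {xinf : ℝ} (hψ : IsCutoff ψ)
    (hh : IsOscillating h xinf) {y : ℝ} (hy : h y ≠ 0) : ψ y = 1 := by
  have := hh.abs_mem hy
  rcases abs_choice y with h1 | h1 <;> rw [h1] at this
  · exact hψ.eq_one y (Or.inr ⟨this.1.le, this.2.le⟩)
  · exact hψ.eq_one y (Or.inl ⟨by linarith [this.2], by linarith [this.1]⟩)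

theorem cascadeSum_apply_xinf {xinf : ℝ} (hψ : IsCutoff ψ) (hh : IsOscillating h xinf)
    (ht : IsSeparated t) (i : ι) :
    cascadeSum ψ q h t τ ((4 : ℝ) ^ (-(t i)) * xinf) = q ((4 : ℝ) ^ (-(t i))) := by
  have hm := four_rpow_neg_mem (ht.nonneg i)
  have hxi := hh.mem
  have habs : |(4 : ℝ) ^ (-(t i)) * xinf| ≤ 1 := by
    rw [abs_of_nonneg (mul_nonneg hm.1 (by linarith [hxi.1]))]
    exact mul_le_one₀ hm.2 (by linarith [hxi.1]) (by linarith [hxi.2])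
  have hmul : (4 : ℝ) ^ t i * ((4 : ℝ) ^ (-(t i)) * xinf) = xinf := by
    rw [← mul_assoc, four_rpow_mul_neg, one_mul]
  have h1 : ψ xinf = 1 := hψ.eq_one _ (Or.inr ⟨hxi.1.le, hxi.2.le⟩)
  rw [cascadeSum_eq_of_mem_annulus hψ.isAnnular hh.isAnnular ht (i := i) habs, hmul, h1,
    hh.apply_eq_zero]
  · ring
  · rw [hψ.isAnnular.cascadeH_eq (ht.nonneg i) habs, hmul, h1]
    exact one_ne_zero

/-- At most one scale acts at `x`. Where `h` vanishes, the value is a convex combination of `q x`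
and the plateau value; where it does not, `ψ = 1` and the value is the plateau value plus a
perturbation. The bound `4^{-(t i + 1)} < x` records the inner radius of the annulus. -/
theorem cascadeSum_cases {xinf B : ℝ} (hψ : IsCutoff ψ) (hq : IsBaseProfile ψ q)
    (hh : IsOscillating h xinf) (hB : ∀ x, |h x| ≤ B) (ht : IsSeparated t) {x : ℝ}
    (hx : x ∈ Icc (0 : ℝ) 1) :
    cascadeSum ψ q h t τ x = q x ∨ ∃ i, (4 : ℝ) ^ (-(t i + 1)) < x ∧
      ((q ((4 : ℝ) ^ (-(t i))) ≤ cascadeSum ψ q h t τ x ∧ cascadeSum ψ q h t τ x ≤ q x) ∨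
        |cascadeSum ψ q h t τ x - q ((4 : ℝ) ^ (-(t i)))| ≤ |τ i| * B) := by
  have habs : |x| ≤ 1 := by rw [abs_of_nonneg hx.1]; exact hx.2
  by_cases hall : ∀ i, cascadeH ψ (t i) x = 0
  · left
    rw [cascadeSum, Finset.sum_eq_zero, add_zero]
    intro i _
    refine cascadeTerm_eq_zero _ (hall i) ?_
    rw [hh.isAnnular.cascadeH_eq (ht.nonneg i) habs]
    by_contra hne
    have := hall i
    rw [hψ.isAnnular.cascadeH_eq (ht.nonneg i) habs, hψ.eq_one_of_oscillating_ne_zero hh hne] at this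
    exact one_ne_zero this
  · right
    obtain ⟨i, hi⟩ := not_forall.1 hall
    have hi' := hi
    rw [hψ.isAnnular.cascadeH_eq (ht.nonneg i) habs] at hi'
    have hann := hψ.isAnnular.ne_zero _ hi'
    have h4 := four_rpow_pos (t i)
    rw [abs_of_nonneg (mul_nonneg h4.le hx.1)] at hann
    have hinv : (4 : ℝ) ^ (-(t i)) = 1 / (4 : ℝ) ^ t i := by
      rw [Real.rpow_neg (by norm_num), one_div]
    have hm := four_rpow_neg_mem (ht.nonneg i)
    have hxlt : x ≤ (4 : ℝ) ^ (-(t i)) := by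
      rw [hinv, le_div_iff₀ h4, mul_comm]; exact hann.2.le
    refine ⟨i, ?_, ?_⟩
    · rw [four_rpow_neg_add_one, hinv, div_div, div_lt_iff₀ (by positivity)]
      linarith [hann.1]
    · rw [cascadeSum_eq_of_mem_annulus hψ.isAnnular hh.isAnnular ht habs hi]
      have hle : q ((4 : ℝ) ^ (-(t i))) ≤ q x := hq.strictAnti.antitoneOn hx hm hxlt
      by_cases hz : h ((4 : ℝ) ^ t i * x) = 0
      · left
        have hψm := hψ.mem_Icc ((4 : ℝ) ^ t i * x)
        rw [hz, mul_zero, add_zero]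
        have a := mul_nonneg hψm.1 (sub_nonneg.2 hle)
        have b := mul_le_mul_of_nonneg_right hψm.2 (sub_nonneg.2 hle)
        constructor <;> linarith
      · right
        rw [hψ.eq_one_of_oscillating_ne_zero hh hz]
        have : q x - 1 * (q x - q ((4 : ℝ) ^ (-(t i)))) + τ i * h ((4 : ℝ) ^ t i * x)
            - q ((4 : ℝ) ^ (-(t i))) = τ i * h ((4 : ℝ) ^ t i * x) := by ring
        rw [this, abs_mul]
        exact mul_le_mul_of_nonneg_left (hB _) (abs_nonneg _)

end Cascade

/-! ### Choice of frequencies and windows, sign conditions, and solution of the system -/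

section Selection

variable {ψ q h : ℝ → ℝ}

/-- The requirements on one frequency `m`, amplitude bound `ε` and window `[M + 1, M']` of scales;
`B` bounds `|h|`. -/
structure IsWindow (q : ℝ → ℝ) (B M : ℝ) (m : ℕ) (ε M' : ℝ) : Prop where
  eps_pos : 0 < ε
  add_two_le : M + 2 ≤ M'
  lower : ((m : ℝ) ^ 2 + (Real.pi / (2 * (4 : ℝ) ^ (-(M + 2)))) ^ 2) * q ((4 : ℝ) ^ (-(M + 1)))
    ≤ (m : ℝ) ^ 2 * q ((4 : ℝ) ^ (-(M + 2)))
  upper : (m : ℝ) ^ 2 * q 0 ≤ ((m : ℝ) ^ 2 + 1 / 100) * q ((4 : ℝ) ^ (-M'))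
  eps_lower : ε * B ≤ q ((4 : ℝ) ^ (-(M + 1))) - q ((4 : ℝ) ^ (-M))
  eps_upper : ε * B ≤ q 0 - q ((4 : ℝ) ^ (-M'))

theorem IsBaseProfile.rpow_lt (hq : IsBaseProfile ψ q) {s t : ℝ} (hs : 0 ≤ s) (hst : s < t) :
    q ((4 : ℝ) ^ (-s)) < q ((4 : ℝ) ^ (-t)) :=
  hq.strictAnti (four_rpow_neg_mem (hs.trans hst.le)) (four_rpow_neg_mem hs)
    (Real.rpow_lt_rpow_of_exponent_lt (by norm_num) (by linarith))

theorem IsBaseProfile.rpow_le (hq : IsBaseProfile ψ q) {s t : ℝ} (hs : 0 ≤ s) (hst : s ≤ t) :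
    q ((4 : ℝ) ^ (-s)) ≤ q ((4 : ℝ) ^ (-t)) := by
  rcases hst.eq_or_lt with rfl | h
  · exact le_rfl
  · exact (hq.rpow_lt hs h).le

theorem IsBaseProfile.rpow_lt_zero (hq : IsBaseProfile ψ q) {s : ℝ} (hs : 0 ≤ s) :
    q ((4 : ℝ) ^ (-s)) < q 0 :=
  hq.strictAnti ⟨le_rfl, zero_le_one⟩ (four_rpow_neg_mem hs) (four_rpow_pos _)

theorem IsBaseProfile.tendsto_rpow (hq : IsBaseProfile ψ q) :
    Tendsto (fun s : ℝ => q ((4 : ℝ) ^ (-s))) atTop (𝓝 (q 0)) := by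
  refine (hq.smooth.continuous.tendsto 0).comp ?_
  exact (tendsto_rpow_atBot_of_base_gt_one 4 (by norm_num)).comp tendsto_neg_atTop_atBot

/-- Strict monotonicity of `q` leaves a gap between its values at `4^{-(M+1)}` and `4^{-(M+2)}`; a
large `m` makes `m²` times this gap exceed the fixed kinetic cost `C`. Next `M'` is taken so large
that `q(4^{-M'})` is close to `q 0`, and finally `ε` is fitted to the two remaining gaps. -/
theorem exists_isWindow (hq : IsBaseProfile ψ q) {B : ℝ} (hB : 0 < B) {M : ℝ} (hM : 0 ≤ M)
    (m₀ : ℕ) : ∃ m ε M', m₀ < m ∧ IsWindow q B M m ε M' := by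
  have hgap : 0 < q ((4 : ℝ) ^ (-(M + 2))) - q ((4 : ℝ) ^ (-(M + 1))) :=
    sub_pos.2 (hq.rpow_lt (by linarith) (by linarith))
  set C := (Real.pi / (2 * (4 : ℝ) ^ (-(M + 2)))) ^ 2 * q ((4 : ℝ) ^ (-(M + 1))) with hC
  obtain ⟨m₁, hm₁⟩ := exists_nat_gt (C / (q ((4 : ℝ) ^ (-(M + 2))) - q ((4 : ℝ) ^ (-(M + 1)))))
  set m := max m₁ (m₀ + 1) with hm
  have hmm : (1 : ℝ) ≤ m := by
    have : 1 ≤ m := le_trans (by omega) (le_max_right m₁ (m₀ + 1))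
    exact_mod_cast this
  have hm1 : C ≤ (m : ℝ) ^ 2 * (q ((4 : ℝ) ^ (-(M + 2))) - q ((4 : ℝ) ^ (-(M + 1)))) := by
    rw [← div_le_iff₀ hgap]
    have h1 : (m₁ : ℝ) ≤ m := by exact_mod_cast le_max_left m₁ (m₀ + 1)
    nlinarith
  have h0 := hq.pos 0
  have hlt : (m : ℝ) ^ 2 * q 0 / ((m : ℝ) ^ 2 + 1 / 100) < q 0 := by
    rw [div_lt_iff₀ (by positivity)]; linarith
  obtain ⟨M', hM'1, hM'2⟩ := ((hq.tendsto_rpow.eventually_const_lt hlt).and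
    (eventually_ge_atTop (M + 2))).exists
  have hA : 0 < q ((4 : ℝ) ^ (-(M + 1))) - q ((4 : ℝ) ^ (-M)) :=
    sub_pos.2 (hq.rpow_lt hM (by linarith))
  have hA' : 0 < q 0 - q ((4 : ℝ) ^ (-M')) := sub_pos.2 (hq.rpow_lt_zero (by linarith))
  refine ⟨m, min (q ((4 : ℝ) ^ (-(M + 1))) - q ((4 : ℝ) ^ (-M))) (q 0 - q ((4 : ℝ) ^ (-M'))) / B,
    M', lt_of_lt_of_le (Nat.lt_succ_self _) (le_max_right _ _),
    div_pos (lt_min hA hA') hB, hM'2, ?_, ?_, ?_, ?_⟩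
  · rw [add_mul]; linarith
  · rw [div_lt_iff₀ (by positivity)] at hM'1; linarith
  · rw [div_mul_cancel₀ _ hB.ne']; exact min_le_left _ _
  · rw [div_mul_cancel₀ _ hB.ne']; exact min_le_right _ _

theorem exists_windows (hq : IsBaseProfile ψ q) {B : ℝ} (hB : 0 < B) :
    ∃ (m : ℕ → ℕ) (ε M : ℕ → ℝ), StrictMono m ∧ (∀ i, 0 < m i) ∧ M 0 = 0 ∧
      ∀ i, IsWindow q B (M i) (m i) (ε i) (M (i + 1)) := by
  choose! fm fε fM hfm hf using fun (M : ℝ) (hM : 0 ≤ M) (m₀ : ℕ) => exists_isWindow hq hB hM m₀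
  -- The state is (left end of the window, last frequency used), so the frequency of window `i` sits
  -- in state `i + 1`.
  let s : ℕ → ℝ × ℕ := fun n => Nat.rec (0, 0) (fun _ p => (fM p.1 p.2, fm p.1 p.2)) n
  have hs0 : ∀ n, 0 ≤ (s n).1 := by
    intro n
    induction n with
    | zero => exact le_rfl
    | succ n ih =>
      have := (hf _ ih (s n).2).add_two_le
      change 0 ≤ fM (s n).1 (s n).2
      linarith
  refine ⟨fun i => (s (i + 1)).2, fun i => fε (s i).1 (s i).2, fun i => (s i).1,
    strictMono_nat_of_lt_succ fun i => hfm _ (hs0 (i + 1)) (s (i + 1)).2,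
    fun i => (Nat.zero_le _).trans_lt (hfm _ (hs0 i) (s i).2), rfl, fun i => hf _ (hs0 i) (s i).2⟩

/-- A family of scales and amplitudes taken from consecutive windows. -/
structure IsSelection (q : ℝ → ℝ) (B : ℝ) (m : ℕ → ℕ) (ε M : ℕ → ℝ) {k : ℕ}
    (τ t : Fin k → ℝ) : Prop where
  zero : M 0 = 0
  window : ∀ i, IsWindow q B (M i) (m i) (ε i) (M (i + 1))
  amp : ∀ i, |τ i| ≤ ε i
  mem : ∀ i : Fin k, t i ∈ Icc (M i + 1) (M (i + 1))

namespace IsSelection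

variable {B xinf : ℝ} {m : ℕ → ℕ} {ε M : ℕ → ℝ} {k : ℕ} {τ t : Fin k → ℝ}

theorem monotone (hs : IsSelection q B m ε M τ t) : Monotone M :=
  monotone_nat_of_le_succ fun i => by linarith [(hs.window i).add_two_le]

theorem nonneg (hs : IsSelection q B m ε M τ t) (i : ℕ) : 0 ≤ M i :=
  hs.zero ▸ hs.monotone (Nat.zero_le i)

theorem add_one_le (hs : IsSelection q B m ε M τ t) {i j : Fin k} (hij : i < j) :
    t i + 1 ≤ t j := by
  have h1 : M (i + 1) ≤ M j := hs.monotone hij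
  linarith [(hs.mem i).2, (hs.mem j).1]

theorem isSeparated (hs : IsSelection q B m ε M τ t) : IsSeparated t := by
  refine ⟨fun i => by linarith [hs.nonneg i, (hs.mem i).1], fun i j hij => ?_⟩
  rw [le_abs]
  rcases lt_or_gt_of_ne hij with h | h
  · right; linarith [hs.add_one_le h]
  · left; linarith [hs.add_one_le h]

theorem amp_mul_le (hs : IsSelection q B m ε M τ t) (hB : 0 < B) (i : Fin k) :
    |τ i| * B ≤ ε i * B :=
  mul_le_mul_of_nonneg_right (hs.amp i) hB.le

/-- The plateau value is at least `q(4^{-(M i + 1)})`, and `eps_lower` allows the oscillation to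
lower it only as far as `q(4^{-M i})`. -/
theorem le_of_abs_sub_le (hs : IsSelection q B m ε M τ t) (hq : IsBaseProfile ψ q) (hB : 0 < B)
    {i : Fin k} {y : ℝ} (hy : |y - q ((4 : ℝ) ^ (-(t i)))| ≤ |τ i| * B) :
    q ((4 : ℝ) ^ (-(M i))) ≤ y := by
  have h1 := (hs.window i).eps_lower
  have h2 := hq.rpow_le (by linarith [hs.nonneg i]) (hs.mem i).1
  linarith [(abs_le.1 hy).1, hs.amp_mul_le hB i]

theorem le_zero_of_abs_sub_le (hs : IsSelection q B m ε M τ t) (hq : IsBaseProfile ψ q)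
    (hB : 0 < B) {i : Fin k} {y : ℝ} (hy : |y - q ((4 : ℝ) ^ (-(t i)))| ≤ |τ i| * B) :
    y ≤ q 0 := by
  have h1 := (hs.window i).eps_upper
  have h2 := hq.rpow_le (hs.isSeparated.nonneg i) (hs.mem i).2
  linarith [(abs_le.1 hy).2, hs.amp_mul_le hB i]

theorem cascadeSum_pos (hψ : IsCutoff ψ) (hq : IsBaseProfile ψ q)
    (hh : IsOscillating h xinf) (hB0 : 0 < B) (hB : ∀ x, |h x| ≤ B) (hs : IsSelection q B m ε M τ t)
    (x : ℝ) : 0 < cascadeSum ψ q h t τ x := by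
  obtain ⟨y, hy, hxy⟩ := exists_mem_Icc_zero_one x
  rw [hxy _ (cascadeSum_even hψ.isAnnular hh.isAnnular hq.even) (cascadeSum_periodic hq.periodic)]
  rcases cascadeSum_cases (τ := τ) hψ hq hh hB hs.isSeparated hy with h1 | ⟨i, -, ⟨h1, -⟩ | h1⟩
  · rw [h1]; exact hq.pos y
  · exact (hq.pos _).trans_le h1
  · exact (hq.pos _).trans_le (hs.le_of_abs_sub_le hq hB0 h1)

theorem cascadeSum_le (hψ : IsCutoff ψ) (hq : IsBaseProfile ψ q)
    (hh : IsOscillating h xinf) (hB0 : 0 < B) (hB : ∀ x, |h x| ≤ B) (hs : IsSelection q B m ε M τ t)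
    (x : ℝ) : cascadeSum ψ q h t τ x ≤ q 0 := by
  obtain ⟨y, hy, hxy⟩ := exists_mem_Icc_zero_one x
  rw [hxy _ (cascadeSum_even hψ.isAnnular hh.isAnnular hq.even) (cascadeSum_periodic hq.periodic)]
  have hy0 : q y ≤ q 0 := hq.strictAnti.antitoneOn ⟨le_rfl, zero_le_one⟩ hy hy.1
  rcases cascadeSum_cases (τ := τ) hψ hq hh hB hs.isSeparated hy with h1 | ⟨i, -, ⟨-, h1⟩ | h1⟩
  · rw [h1]; exact hy0
  · exact h1.trans hy0
  · exact hs.le_zero_of_abs_sub_le hq hB0 h1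

/-- The radius `4^{-(M i + 2)}` is the inner radius of the annulus of `t i = M i + 1`, so neither
this scale nor an earlier one acts so close to `2`. A later scale `j` keeps the value above `q(4^{-M
j})` on its oscillating part and above `q(4^{-t j})` elsewhere, and `M j ≥ M i + 2`. -/
theorem le_cascadeSum (hψ : IsCutoff ψ) (hq : IsBaseProfile ψ q)
    (hh : IsOscillating h xinf) (hB0 : 0 < B) (hB : ∀ x, |h x| ≤ B) (hs : IsSelection q B m ε M τ t)
    {i : Fin k} (hi : t i = M i + 1) {x : ℝ}
    (hx : x ∈ Icc (2 - (4 : ℝ) ^ (-(M i + 2))) (2 + (4 : ℝ) ^ (-(M i + 2)))) :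
    q ((4 : ℝ) ^ (-(M i + 2))) ≤ cascadeSum ψ q h t τ x := by
  have hMi := hs.nonneg i
  have hδ := four_rpow_neg_mem (by linarith : 0 ≤ M i + 2)
  set y := |x - 2| with hy
  have hyδ : y ≤ (4 : ℝ) ^ (-(M i + 2)) := abs_le.2 ⟨by linarith [hx.1], by linarith [hx.2]⟩
  have hymem : y ∈ Icc (0 : ℝ) 1 := ⟨abs_nonneg _, hyδ.trans hδ.2⟩
  have he := cascadeSum_even (t := t) (τ := τ) hψ.isAnnular hh.isAnnular hq.even
  have hxy : cascadeSum ψ q h t τ x = cascadeSum ψ q h t τ y := by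
    have h1 := cascadeSum_periodic (ψ := ψ) (h := h) (t := t) (τ := τ) hq.periodic (x - 2)
    rw [sub_add_cancel] at h1
    rw [h1, hy]
    rcases abs_choice (x - 2) with h | h <;> rw [h]
    rw [he]
  rw [hxy]
  -- A scale acting at `y` must exceed `t i`, hence belongs to a later window.
  have later : ∀ j : Fin k, (4 : ℝ) ^ (-(t j + 1)) < y → M i + 2 ≤ M j := by
    intro j hj
    have h1 : M i + 1 < t j := by
      by_contra hcon
      have := four_rpow_le (by linarith : -(M i + 2) ≤ -(t j + 1))
      linarith
    have hij : i < j := by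
      by_contra hcon
      have := (hs.mem i).1
      rcases (not_lt.1 hcon).eq_or_lt with h | h
      · rw [h] at h1; linarith
      · linarith [hs.add_one_le h]
    exact (hs.window i).add_two_le.trans (hs.monotone hij)
  rcases cascadeSum_cases (τ := τ) hψ hq hh hB hs.isSeparated hymem with
    h1 | ⟨j, hj, ⟨h1, -⟩ | h1⟩
  · rw [h1]; exact hq.strictAnti.antitoneOn hymem hδ hyδ
  · refine (hq.rpow_le (by linarith) ?_).trans h1
    linarith [later j hj, (hs.mem j).1]
  · exact (hq.rpow_le (by linarith) (later j hj)).trans (hs.le_of_abs_sub_le hq hB0 h1)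

theorem continuous_cascadeSum (hψ : IsCutoff ψ) (hq : IsBaseProfile ψ q)
    (hh : IsOscillating h xinf) (hs : IsSelection q B m ε M τ t) :
    Continuous (cascadeSum ψ q h t τ) :=
  (contDiff_cascadeSum hψ.isAnnular hh.isAnnular hq.smooth hs.isSeparated.nonneg).continuous

theorem isWeight_cascadeSum (hψ : IsCutoff ψ) (hq : IsBaseProfile ψ q)
    (hh : IsOscillating h xinf) (hB0 : 0 < B) (hB : ∀ x, |h x| ≤ B) (hs : IsSelection q B m ε M τ t) :
    IsWeight (cascadeSum ψ q h t τ) :=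
  ⟨contDiff_cascadeSum hψ.isAnnular hh.isAnnular hq.smooth hs.isSeparated.nonneg,
    cascadeSum_pos hψ hq hh hB0 hB hs,
    cascadeSum_even hψ.isAnnular hh.isAnnular hq.even, cascadeSum_periodic hq.periodic⟩

theorem groundLevel_le_of_eq_left (hψ : IsCutoff ψ) (hq : IsBaseProfile ψ q)
    (hh : IsOscillating h xinf) (hB0 : 0 < B) (hB : ∀ x, |h x| ≤ B) (hs : IsSelection q B m ε M τ t)
    {i : Fin k} (hi : t i = M i + 1) :
    groundLevel (cascadeSum ψ q h t τ) (m i) * q ((4 : ℝ) ^ (-(t i))) - (m i : ℝ) ^ 2 ≤ 0 := by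
  have hMi := hs.nonneg i
  have hδ := four_rpow_neg_mem (by linarith : 0 ≤ M i + 2)
  have h1 := groundLevel_mul_le (m := m i) (continuous_cascadeSum hψ hq hh hs)
    (cascadeSum_pos hψ hq hh hB0 hB hs) (four_rpow_pos (-(M i + 2))) (by linarith [hδ.2])
    fun x hx => le_cascadeSum hψ hq hh hB0 hB hs hi hx
  have ha := hq.pos ((4 : ℝ) ^ (-(M i + 1)))
  have hd := hq.pos ((4 : ℝ) ^ (-(M i + 2)))
  have h2 := (mul_le_mul_of_nonneg_right h1 ha.le).trans (hs.window i).lower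
  rw [hi, sub_nonpos]
  rw [mul_right_comm] at h2
  exact le_of_mul_le_mul_right h2 hd

theorem le_groundLevel_of_eq_right (hψ : IsCutoff ψ) (hq : IsBaseProfile ψ q)
    (hh : IsOscillating h xinf) (hB0 : 0 < B) (hB : ∀ x, |h x| ≤ B) (hs : IsSelection q B m ε M τ t)
    {i : Fin k} (hi : t i = M (i + 1)) :
    0 ≤ groundLevel (cascadeSum ψ q h t τ) (m i) * q ((4 : ℝ) ^ (-(t i))) - (m i : ℝ) ^ 2 := by
  have h1 := le_groundLevel_mul (m := m i) (continuous_cascadeSum hψ hq hh hs)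
    (cascadeSum_pos hψ hq hh hB0 hB hs) (cascadeSum_le hψ hq hh hB0 hB hs)
  have ha := hq.pos ((4 : ℝ) ^ (-(M (i + 1))))
  have h0 := hq.pos 0
  have h2 := (hs.window i).upper.trans (mul_le_mul_of_nonneg_right h1 ha.le)
  rw [hi, sub_nonneg]
  rw [mul_right_comm] at h2
  exact le_of_mul_le_mul_right h2 h0

end IsSelection

/-- Every point of the box of windows is an admissible selection, so the face estimates hold
whatever the other coordinates are, exactly as Poincaré–Miranda requires. -/
theorem exists_resonant_scales {B xinf : ℝ} {m : ℕ → ℕ} {ε M : ℕ → ℝ} {k : ℕ} {τ : Fin k → ℝ}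
    (hψ : IsCutoff ψ) (hq : IsBaseProfile ψ q) (hh : IsOscillating h xinf) (hB0 : 0 < B)
    (hB : ∀ x, |h x| ≤ B) (h0 : M 0 = 0) (hw : ∀ i, IsWindow q B (M i) (m i) (ε i) (M (i + 1)))
    (hτ : ∀ i, |τ i| ≤ ε i) :
    ∃ t : Fin k → ℝ, IsSelection q B m ε M τ t ∧ ∀ i : Fin k,
      groundLevel (cascadeSum ψ q h t τ) (m i) * q ((4 : ℝ) ^ (-(t i))) = (m i : ℝ) ^ 2 := by
  set a : Fin k → ℝ := fun i => M i + 1 with ha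
  set b : Fin k → ℝ := fun i => M (i + 1) with hb
  have hsel : ∀ t ∈ Icc a b, IsSelection q B m ε M τ t := fun t ht =>
    ⟨h0, hw, hτ, fun i => ⟨ht.1 i, ht.2 i⟩⟩
  have h4 : Continuous fun t : ℝ => (4 : ℝ) ^ (-t) :=
    (Real.continuous_const_rpow (by norm_num)).comp continuous_neg
  have hq4 : ∀ i : Fin k, Continuous fun t : Fin k → ℝ => q ((4 : ℝ) ^ (-(t i))) := fun i =>
    hq.smooth.continuous.comp (h4.comp (continuous_apply i))
  have hG : ∀ n : ℝ, ContinuousOn (fun t => groundLevel (cascadeSum ψ q h t τ) n) (Icc a b) :=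
    fun n => continuousOn_groundLevel isCompact_Icc
      (continuousOn_cascadeSum hψ.isAnnular hh.isAnnular hq.smooth.continuous
        fun t ht => (hsel t ht).isSeparated.nonneg)
      (fun t ht => (hsel t ht).continuous_cascadeSum hψ hq hh)
      (fun t ht => (hsel t ht).cascadeSum_pos hψ hq hh hB0 hB)
  have hcont : ContinuousOn (fun (t : Fin k → ℝ) (i : Fin k) =>
      groundLevel (cascadeSum ψ q h t τ) (m i) * q ((4 : ℝ) ^ (-(t i))) - (m i : ℝ) ^ 2)
      (Icc a b) :=
    continuousOn_pi.2 fun i => ((hG (m i)).mul (hq4 i).continuousOn).sub continuousOn_const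
  obtain ⟨t, ht, hzero⟩ := exists_zero_of_sign_on_faces
    (fun i => by simp only [ha, hb]; linarith [(hw i).add_two_le]) hcont
    (fun i t ht hi => (hsel t ht).groundLevel_le_of_eq_left hψ hq hh hB0 hB hi)
    (fun i t ht hi => (hsel t ht).le_groundLevel_of_eq_right hψ hq hh hB0 hB hi)
  exact ⟨t, hsel t ht, fun i => sub_eq_zero.1 (congrFun hzero i)⟩

end Selection

theorem mainTheorem2 (ψ q h : ℝ → ℝ) (xinf : ℝ) (hψ : IsCutoff ψ) (hq : IsBaseProfile ψ q)
    (hh : IsOscillating h xinf) :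
    ∃ (m : ℕ → ℕ) (ε : ℕ → ℝ) (M : ℕ → ℝ),
      StrictMono m ∧ (∀ i, 0 < m i) ∧ (∀ i, 0 < ε i) ∧
      M 0 = 0 ∧ (∀ i, M i + 1 < M (i + 1)) ∧
      ∀ (k : ℕ) (τ : Fin k → ℝ), (∀ i, |τ i| ≤ ε i) →
        ∃ t : Fin k → ℝ, (∀ i : Fin k, t i ∈ Set.Icc (M i + 1) (M (i + 1))) ∧
          ∃ (S : Finset ℝ) (hS : (S : Set ℝ) = Set.range t) (σ : S → ℝ),
            (∀ i, σ ⟨t i, Finset.mem_coe.1 (hS ▸ Set.mem_range_self i)⟩ = τ i) ∧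
            IsWeight (cascade ψ q h S σ) ∧
            ∀ i : Fin k, ∃ L : ℝ,
              IsFirstDirichletEigenvalue (cascade ψ q h S σ) (m i) L ∧
              L * cascade ψ q h S σ ((4 : ℝ) ^ (-(t i)) * xinf) = (m i : ℝ) ^ 2 := by
  classical
  obtain ⟨B, hB0, hB⟩ := hh.exists_bound
  obtain ⟨m, ε, M, hm, hm0, hM0, hw⟩ := exists_windows hq hB0
  refine ⟨m, ε, M, hm, hm0, fun i => (hw i).eps_pos, hM0,
    fun i => by linarith [(hw i).add_two_le], fun k τ hτ => ?_⟩
  obtain ⟨t, hs, hres⟩ := exists_resonant_scales hψ hq hh hB0 hB hM0 hw hτ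
  -- Separated scales are distinct, so the amplitudes become a function of the scale; the default
  -- value `0` is never seen on `S`.
  have hT : ∀ i, Function.extend t τ 0 (t i) = τ i := hs.isSeparated.injective.extend_apply τ 0
  have hcas := cascade_image_eq (q := q) hψ.isAnnular hh.isAnnular hs.isSeparated hT
  have hwt := hs.isWeight_cascadeSum hψ hq hh hB0 hB
  refine ⟨t, hs.mem, Finset.univ.image t, by simp, fun s => Function.extend t τ 0 s, hT, ?_,
    fun i => ⟨groundLevel (cascadeSum ψ q h t τ) (m i), ?_, ?_⟩⟩
  · rw [hcas]; exact hwt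
  · rw [hcas]
    exact isFirstDirichletEigenvalue_groundLevel hwt.smooth.continuous hwt.pos
  · rw [hcas, cascadeSum_apply_xinf hψ hh hs.isSeparated, hres]
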